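/- All manifolds and maps are smooth; manifolds are Hausdorff and may have boundary. Let $Y^3$ be a submanifold of a 5-manifold $W^5$, let $\gamma\subset Y$ be an embedded circle, and let $\Delta\subset W$ be an embedded closed 2-disk with $\partial\Delta=\gamma$ and $\mathring\Delta\cap Y=\emptyset$. Let $R\subset W$ be an embedded 2-sphere with trivial normal bundle $N_W(R)=TW|_R/TR$ that is disjoint from $\Delta$ and from $Y$. Let $\widetilde\Delta$ be an embedded disk obtained from $\Delta$ by tubing $\Delta$ to $R$: for some smooth coordinates $(x,z,w)\in\{x\in\mathbb R^2:|x|<2\}\times(-1,2)\times\{w\in\mathbb R^2:|w|<1\}$ on an open subset of $W\setminus\gamma$, which $\Delta$ meets exactly in $\{z=0,\,w=0\}$ and $R$ exactly in $\{z=1,\,w=0\}$, the disk $\widetilde\Delta$ is obtained from $\Delta\cup R$ by removing the open disks $\{|x|<1,\,z=0,\,w=0\}$ and $\{|x|<1,\,z=1,\,w=0\}$ and gluing in a tube with rounded corners around the arc $\{x=0,\,w=0,\,0\le z\le1\}$, that is, a surface of revolution $\{w=0,\ (|x|,z)\in c\}$, where $c$ is an arc from $(1,0)$ to $(1,1)$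 whose interior lies in $(0,1)\times[0,1]$ and which, together with the rays $[1,\infty)\times\{0\}$ and $[1,\infty)\times\{1\}$, forms a smooth embedded curve. Assume that $\partial\widetilde\Delta=\gamma$ and that the interior of $\widetilde\Delta$ is disjoint from $Y$. For a disk $D\in\{\Delta,\widetilde\Delta\}$ with normal bundle $N_W(D)=TW|_D/TD$, a framing $\phi=(\phi_1,\phi_2)$ of $N_Y(\gamma)=TY|_\gamma/T\gamma$ is called $D$-admissible if there is a 2-dimensional subbundle $B\subset N_W(D)$ with a framing that extends $\phi$ (under the natural map $N_Y(\gamma)\to N_W(D)|_\gamma$). Then a framing $\phi$ of $N_Y(\gamma)$ is $\Delta$-admissible if and only if it is $\widetilde\Delta$-admissible. -/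

import Mathlib

open Set Metric
open scoped Manifold ContDiff

namespace Tubing

/-- Euclidean `n`-space. -/
abbrev Euc (n : ℕ) : Type := EuclideanSpace ℝ (Fin n)

/-- The closed unit disk `D²` as a subset of the plane. -/
abbrev disk : Set (Euc 2) := closedBall 0 1

/-- The unit circle `S¹`. -/
abbrev Circ : Type := sphere (0 : Euc 2) 1

/-- The unit sphere `S²`. -/
abbrev Sph : Type := sphere (0 : Euc 3) 1

section Normal

variable {E H M E' H' N : Type*}
  [NormedAddCommGroup E] [NormedSpace ℝ E] [TopologicalSpace H]
  [TopologicalSpace M] [ChartedSpace H M]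
  [NormedAddCommGroup E'] [NormedSpace ℝ E'] [TopologicalSpace H']
  [TopologicalSpace N] [ChartedSpace H' N]

/-- The tangent space of the image of `f : S → N` at `f x`, i.e. the image of the differential,
where `S` is a subset of the manifold `M` (one-sided derivatives at the boundary of `S`). -/
noncomputable def tangentImage (J : ModelWithCorners ℝ E H) (I : ModelWithCorners ℝ E' H')
    (f : M → N) (S : Set M) (x : M) : Submodule ℝ (TangentSpace I (f x)) :=
  LinearMap.range (mfderivWithin J I f S x).toLinearMap

/-- The fibre at `x` of the normal bundle of `f : S → N`: the quotient `T_{f x}N / df(T_x S)`. -/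
abbrev NormalSpace (J : ModelWithCorners ℝ E H) (I : ModelWithCorners ℝ E' H')
    (f : M → N) (S : Set M) (x : M) : Type _ :=
  TangentSpace I (f x) ⧸ tangentImage J I f S x

/-- A section of the normal bundle of `f` over `S` is smooth if it is represented by a smooth
vector field along `f`, i.e. if it is the image of a smooth section of `f^* TN` over `S`.
Values of `s` outside `S` are irrelevant. -/
def IsSmoothSection (J : ModelWithCorners ℝ E H) (I : ModelWithCorners ℝ E' H') [IsManifold I ∞ N]
    (f : M → N) (S : Set M) (s : ∀ x, NormalSpace J I f S x) : Prop :=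
  ∃ V : ∀ x, TangentSpace I (f x),
    ContMDiffOn J I.tangent ∞ (fun x ↦ (⟨f x, V x⟩ : TangentBundle I N)) S ∧
      ∀ x ∈ S, s x = Submodule.Quotient.mk (V x)

/-- `φ` is a framing (trivialization) of the rank `k` subbundle `B` of the normal bundle of `f`
over `S`: `k` smooth sections that form a basis of `B x` for each `x ∈ S`. (This forces `B` to be
a smooth subbundle of rank `k`.) -/
structure IsFraming (J : ModelWithCorners ℝ E H) (I : ModelWithCorners ℝ E' H') [IsManifold I ∞ N]
    (f : M → N) (S : Set M) (B : ∀ x, Submodule ℝ (NormalSpace J I f S x)) {k : ℕ}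
    (φ : Fin k → ∀ x, NormalSpace J I f S x) : Prop where
  smooth : ∀ i, IsSmoothSection J I f S (φ i)
  linearIndependent : ∀ x ∈ S, LinearIndependent ℝ (fun i ↦ φ i x)
  span_eq : ∀ x ∈ S, Submodule.span ℝ (range fun i ↦ φ i x) = B x

/-- The normal bundle of `f : M → N`, of rank `k`, is trivial: it has a global framing. -/
def HasTrivialNormalBundle (J : ModelWithCorners ℝ E H) (I : ModelWithCorners ℝ E' H')
    [IsManifold I ∞ N] (k : ℕ) (f : M → N) : Prop :=
  ∃ φ : Fin k → ∀ x, NormalSpace J I f univ x, IsFraming J I f univ (fun _ ↦ ⊤) φ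

end Normal

section Surgery

variable {H W H' Y : Type*}
  [TopologicalSpace H] [TopologicalSpace W] [ChartedSpace H W]
  [TopologicalSpace H'] [TopologicalSpace Y] [ChartedSpace H' Y]

/-- `f : D² → W` is a smooth embedding of the closed disk: smooth up to the boundary, with
everywhere injective differential, and injective (hence an embedding, as `D²` is compact). -/
structure IsEmbeddedDisk (I : ModelWithCorners ℝ (Euc 5) H) (f : Euc 2 → W) : Prop where
  smooth : ContMDiffOn 𝓘(ℝ, Euc 2) I ∞ f disk
  injOn : InjOn f disk
  immersive : ∀ x ∈ disk, Function.Injective (mfderivWithin 𝓘(ℝ, Euc 2) I f disk x)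

/-- `f : D² → W` is an embedded disk whose boundary is the circle `γ ⊂ Y` and whose interior is
disjoint from `Y`; here `Y` is a submanifold of `W` through `ι : Y → W`. -/
structure IsSpanningDisk (I : ModelWithCorners ℝ (Euc 5) H) (ι : Y → W) (γ : Circ → Y)
    (f : Euc 2 → W) : Prop where
  embedded : IsEmbeddedDisk I f
  boundary_eq : f '' sphere 0 1 = range (ι ∘ γ)
  interior_disjoint : Disjoint (f '' ball 0 1) (range ι)

/-- A pair `φ` of sections of the normal bundle `N_Y(γ)`. -/
abbrev NormalPair (J : ModelWithCorners ℝ (Euc 3) H') (γ : Circ → Y) : Type _ :=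
  Fin 2 → ∀ θ, NormalSpace (𝓡 1) J γ univ θ

/-- The framing `φ` of `N_Y(γ)` is admissible for the disk `f`, where `∂f = γ`: there is a
subbundle `B` of rank 2 of the normal bundle `N_W(f)` with a framing `Φ` that extends `φ` under the
natural map `N_Y(γ) = TY/Tγ → TW/Tf = N_W(f)` over `γ`. The last clause says that `Φ i x` is the
image of `φ i θ` where `x ∈ ∂D²` and `θ` correspond to the same point of `γ`. -/
def IsAdmissible (J : ModelWithCorners ℝ (Euc 3) H') (I : ModelWithCorners ℝ (Euc 5) H)
    [IsManifold I ∞ W] (ι : Y → W) (γ : Circ → Y) (f : Euc 2 → W) (φ : NormalPair J γ) : Prop :=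
  ∃ (B : ∀ x, Submodule ℝ (NormalSpace 𝓘(ℝ, Euc 2) I f disk x))
    (Φ : Fin 2 → ∀ x, NormalSpace 𝓘(ℝ, Euc 2) I f disk x),
    IsFraming 𝓘(ℝ, Euc 2) I f disk B Φ ∧
      ∀ x ∈ sphere (0 : Euc 2) 1, ∀ θ : Circ, f x = ι (γ θ) →
        ∀ (i : Fin 2) (v : TangentSpace J (γ θ)), Submodule.Quotient.mk v = φ i θ →
          Φ i x = Submodule.Quotient.mk (show TangentSpace I (f x) from mfderiv J I ι (γ θ) v)

/-- Local model of a neighbourhood of the tube, with coordinates `(x, z, w) ∈ ℝ² × ℝ × ℝ²`. The arc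
is `x = 0, w = 0, 0 ≤ z ≤ 1`, the disk is `z = 0, w = 0`, the sphere is `z = 1, w = 0`. -/
abbrev Model : Type := Euc 2 × ℝ × Euc 2

/-- The domain of the local model. -/
def modelBox : Set Model := {q | ‖q.1‖ < 2 ∧ -1 < q.2.1 ∧ q.2.1 < 2 ∧ ‖q.2.2‖ < 1}

/-- The open unit disk around the axis at height `h`. -/
def modelDisk (h : ℝ) : Set Model := {q | ‖q.1‖ < 1 ∧ q.2.1 = h ∧ q.2.2 = 0}

/-- A profile of a tube with rounded corners: `t ↦ (r t, z t)` is a smooth regular simple curve in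
the half plane `r > 0` that comes in along the line `z = 0` until `r = 1`, stays in
`0 < r < 1, 0 ≤ z ≤ 1` and goes out along `z = 1` from `r = 1` on. -/
structure IsTubeProfile (r z : ℝ → ℝ) : Prop where
  smooth_r : ContDiff ℝ ∞ r
  smooth_z : ContDiff ℝ ∞ z
  regular : ∀ t, deriv r t ≠ 0 ∨ deriv z t ≠ 0
  injective : Function.Injective fun t ↦ (r t, z t)
  incoming : ∀ t ≤ -1, r t = -t ∧ z t = 0
  outgoing : ∀ t, 1 ≤ t → r t = t ∧ z t = 1
  middle : ∀ t, -1 < t → t < 1 → 0 < r t ∧ r t < 1 ∧ 0 ≤ z t ∧ z t ≤ 1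

/-- The tube: the surface of revolution of the profile around the axis, in `w = 0`. -/
def modelTube (r z : ℝ → ℝ) : Set Model :=
  {q | ∃ t ∈ Icc (-1 : ℝ) 1, ‖q.1‖ = r t ∧ q.2.1 = z t ∧ q.2.2 = 0}

/-- `f'` is a disk obtained by tubing the disk `f` to the sphere `R` along a framed arc: the framed
arc is given with a neighbourhood by a diffeomorphism `Ψ` from the box onto an open subset of `W`,
in which the disk and the sphere are the planes `z = 0, w = 0` and `z = 1, w = 0`; a small open disk
around each end of the arc is removed from the disk and the sphere, and the tube (with rounded
corners) is glued in. The arc stays away from the boundary of the disk, and `f'` is an embedded disk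
that has the resulting surface as its image and the same boundary as `f`. -/
def IsTubing (I : ModelWithCorners ℝ (Euc 5) H) (f : Euc 2 → W) (R : Sph → W) (f' : Euc 2 → W) :
    Prop :=
  IsEmbeddedDisk I f' ∧ f' '' sphere 0 1 = f '' sphere 0 1 ∧
  ∃ (Ψ : OpenPartialHomeomorph Model W) (r z : ℝ → ℝ),
    Ψ.source = modelBox ∧
    ContMDiffOn 𝓘(ℝ, Model) I ∞ Ψ Ψ.source ∧
    ContMDiffOn I 𝓘(ℝ, Model) ∞ Ψ.symm Ψ.target ∧
    (∀ q ∈ modelBox, Ψ q ∈ f '' disk ↔ q.2.1 = 0 ∧ q.2.2 = 0) ∧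
    (∀ q ∈ modelBox, Ψ q ∈ range R ↔ q.2.1 = 1 ∧ q.2.2 = 0) ∧
    Disjoint Ψ.target (f '' sphere 0 1) ∧
    IsTubeProfile r z ∧
    f' '' disk = (f '' disk \ Ψ '' modelDisk 0) ∪ (range R \ Ψ '' modelDisk 1) ∪
      Ψ '' modelTube r z

end Surgery

end Tubing

open Tubing

/-!
The normal bundle of `Δ` is trivial because the disk is contractible, and that of `R` by
assumption. After a constant linear change of the framing of `R`, which makes the framings of `Δ`
and `R` match at the two ends of the arc, they extend along the tube to a framing of the normal
bundle of `Δ'` that coincides with that of `Δ` on the common boundary circle. With respect to such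
framings of `Δ` and `Δ'`, a pair of independent normal fields is a map to the pairs of independent
vectors in `ℝ³`, so the pairs of one disk are carried to the other by any smooth map `D² → D²` that
extends the reparametrization of the boundary.
-/

namespace Tubing

open Filter Topology Bundle

/-! ### Lifting smooth maps through immersions -/

section Immersion

variable {E F G : Type*} [NormedAddCommGroup E] [NormedSpace ℝ E]
  [NormedAddCommGroup F] [NormedSpace ℝ F] [NormedAddCommGroup G] [NormedSpace ℝ G]

theorem contDiffOn_of_hasFDerivWithinAt_comp {g : G → E} {S : Set E} {T : Set G}
    (hT : UniqueDiffOn ℝ T) (hgT : MapsTo g T S) {A : E → F →L[ℝ] E} {B : G → G →L[ℝ] F}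
    (hA : ContDiffOn ℝ ∞ A S) (hB : ContDiffOn ℝ ∞ B T)
    (hg : ∀ y ∈ T, HasFDerivWithinAt g (A (g y) ∘L B y) T y) : ContDiffOn ℝ ∞ g T := by
  refine contDiffOn_infty.2 fun n ↦ ?_
  induction n with
  | zero => exact contDiffOn_zero.2 fun y hy ↦ (hg y hy).continuousWithinAt
  | succ n ih =>
    rw [Nat.cast_succ, contDiffOn_succ_iff_hasFDerivWithinAt_of_uniqueDiffOn hT]
    have hn : (n : ℕ∞ω) ≤ ∞ := by exact_mod_cast le_top
    exact ⟨fun h ↦ absurd h (WithTop.natCast_ne_top n), fun y ↦ A (g y) ∘L B y,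
      ((hA.of_le hn).comp ih hgT).clm_comp (hB.of_le hn), hg⟩

/-- If `f ∘ g = h` with `f` immersive, then `g` has the derivative `(p ∘ f')⁻¹ ∘ p ∘ h'` for any
linear map `p` such that `p ∘ f'` is invertible; this determines `g'` smoothly in terms of `g`. -/
theorem contDiffWithinAt_of_comp_immersion [FiniteDimensional ℝ E] [FiniteDimensional ℝ F]
    {f : E → F} {g : G → E} {h : G → F} {S : Set E} {T : Set G} {x : G} (hx : x ∈ T)
    (hS : UniqueDiffOn ℝ S) (hT : UniqueDiffOn ℝ T) (hf : ContDiffOn ℝ ∞ f S)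
    (hg : ContinuousOn g T) (hgT : MapsTo g T S) (hh : ContDiffOn ℝ ∞ h T)
    (heq : ∀ y ∈ T, f (g y) = h y) (hinj : Function.Injective (fderivWithin ℝ f S (g x))) :
    ContDiffWithinAt ℝ ∞ g T x := by
  obtain ⟨p, hp⟩ := LinearMap.exists_leftInverse_of_injective
    (fderivWithin ℝ f S (g x)).toLinearMap (LinearMap.ker_eq_bot.2 hinj)
  let A (y : E) : E →L[ℝ] E := p.toContinuousLinearMap ∘L fderivWithin ℝ f S y
  have hA : ContDiffOn ℝ ∞ A S := contDiffOn_const.clm_comp (hf.fderivWithin hS le_rfl)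
  let S' : Set E := S ∩ {y | (A y).IsInvertible}
  have hxS' : {y | (A (g y)).IsInvertible} ∈ 𝓝[T] x :=
    ((hA.continuousOn.comp hg hgT) x hx).eventually_mem <|
      ContinuousLinearEquiv.isOpen.mem_nhds (mem_range.2
        ⟨.refl ℝ E, ContinuousLinearMap.ext fun v ↦ (LinearMap.congr_fun hp v).symm⟩)
  obtain ⟨u, hu, hxu, huT⟩ := mem_nhdsWithin.1 hxS'
  have hinv : ContDiffOn ℝ ∞ (fun y ↦ (A y).inverse ∘L p.toContinuousLinearMap) S' := by
    refine ContDiffOn.clm_comp (fun y hy ↦ ?_) contDiffOn_const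
    obtain ⟨e, he⟩ := hy.2
    have := contDiffAt_map_inverse (n := ∞) e
    rw [he] at this
    exact this.comp_contDiffWithinAt y ((hA y hy.1).mono inter_subset_left)
  refine (contDiffOn_of_hasFDerivWithinAt_comp (S := S') (hT.inter hu)
    (fun y hy ↦ ⟨hgT hy.1, huT hy.symm⟩) hinv ((hh.fderivWithin hT le_rfl).mono inter_subset_left)
    (fun y hy ↦ ?_) x
    ⟨hx, hxu⟩).mono_of_mem_nhdsWithin (inter_mem_nhdsWithin _ (hu.mem_nhds hxu))
  refine HasFDerivWithinAt.of_comp_of_leftInverse (t := S)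
    ((hg.mono inter_subset_left y hy).tendsto_nhdsWithin fun z hz ↦ hgT hz.1)
    (hf.differentiableOn (by simp) _ (hgT hy.1)).hasFDerivWithinAt
    ((hh.differentiableOn (by simp) _ hy.1).hasFDerivWithinAt.mono inter_subset_left)
    (eventually_mem_nhdsWithin.mono fun z hz ↦ heq z hz.1) (fun v ↦ ?_) hy
  exact (huT hy.symm : (A (g y)).IsInvertible).inverse_apply_self v

end Immersion

section ManifoldImmersion

variable {E M E' H' N G : Type*}
  [NormedAddCommGroup E] [NormedSpace ℝ E] [TopologicalSpace M] [ChartedSpace E M]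
  [NormedAddCommGroup E'] [NormedSpace ℝ E'] [TopologicalSpace H']
  [TopologicalSpace N] [ChartedSpace H' N] {I : ModelWithCorners ℝ E' H'}
  [NormedAddCommGroup G] [NormedSpace ℝ G]

theorem injective_mfderiv_of_isImmersionAt [IsManifold 𝓘(ℝ, E) ∞ M] {f : M → N} {x : M}
    (h : Manifold.IsImmersionAt 𝓘(ℝ, E) I ∞ f x) :
    Function.Injective (mfderiv 𝓘(ℝ, E) I f x) := by
  have : IsManifold 𝓘(ℝ, E) 1 M := .of_le (n := ∞) (by simp)
  let i : E →L[ℝ] E' := (h.equiv : E × h.complement →L[ℝ] E') ∘L .inl ℝ E h.complement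
  have hi : Function.Injective i := h.equiv.injective.comp (Prod.mk_left_injective 0)
  have hdom : h.domChart.MDifferentiable 𝓘(ℝ, E) 𝓘(ℝ, E) :=
    ⟨fun y hy ↦ (mdifferentiableAt_of_mem_maximalAtlas
        (IsManifold.maximalAtlas_subset_of_le (n := ∞) (by simp) h.domChart_mem_maximalAtlas)
        hy).mdifferentiableWithinAt,
      fun y hy ↦ (mdifferentiableAt_symm_of_mem_maximalAtlas
        (IsManifold.maximalAtlas_subset_of_le (n := ∞) (by simp) h.domChart_mem_maximalAtlas)
        hy).mdifferentiableWithinAt⟩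
  have hcod : MDifferentiableAt I 𝓘(ℝ, E') (h.codChart.extend I) (f x) :=
    (h.codChart.contMDiffAt_extend h.codChart_mem_maximalAtlas
      h.mem_codChart_source).mdifferentiableAt (by simp)
  have heq : h.codChart.extend I ∘ f =ᶠ[𝓝 x] i ∘ h.domChart := by
    filter_upwards [h.domChart.open_source.mem_nhds h.mem_domChart_source] with y hy
    have := h.writtenInCharts (h.domChart.extend 𝓘(ℝ, E) |>.map_source (by simpa using hy))
    simpa [i, hy] using this
  have hcomp : Function.Injective (mfderiv 𝓘(ℝ, E) 𝓘(ℝ, E') (h.codChart.extend I ∘ f) x) := by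
    rw [heq.mfderiv_eq, mfderiv_comp x i.differentiableAt.mdifferentiableAt
      (hdom.mdifferentiableAt h.mem_domChart_source), mfderiv_eq_fderiv, i.fderiv]
    exact hi.comp (hdom.mfderiv_injective h.mem_domChart_source)
  rw [mfderiv_comp x hcod (h.contMDiffAt.mdifferentiableAt (by simp))] at hcomp
  exact fun a b hab ↦ hcomp (congrArg (mfderiv I 𝓘(ℝ, E') (h.codChart.extend I) (f x)) hab)

theorem injective_fderivWithin_writtenInExtChartAt {f : M → N} {S : Set M} {y : M}
    (hf : MDifferentiableWithinAt 𝓘(ℝ, E) I f S y)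
    (hinj : Function.Injective (mfderivWithin 𝓘(ℝ, E) I f S y)) :
    Function.Injective (fderivWithin ℝ (writtenInExtChartAt 𝓘(ℝ, E) I y f)
      ((extChartAt 𝓘(ℝ, E) y).target ∩ (extChartAt 𝓘(ℝ, E) y).symm ⁻¹' S)
      (extChartAt 𝓘(ℝ, E) y y)) := by
  rw [inter_comm, fderivWithin_inter (extChartAt_target_mem_nhds y)]
  rw [hf.mfderivWithin] at hinj
  simp only [modelWithCornersSelf_coe, range_id, inter_univ] at hinj
  exact hinj

variable [FiniteDimensional ℝ E] [FiniteDimensional ℝ E'] [IsManifold 𝓘(ℝ, E) ∞ M]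
  [IsManifold I ∞ N] {f : M → N} {g : G → M} {h : G → N} {S : Set M} {T : Set G}

theorem contMDiffWithinAt_of_comp_immersion_of_mapsTo {x : G} (hx : x ∈ T)
    (hS : UniqueMDiffOn 𝓘(ℝ, E) S) (hT : UniqueDiffOn ℝ T) (hf : ContMDiffOn 𝓘(ℝ, E) I ∞ f S)
    (hg : ContinuousOn g T) (hgT : MapsTo g T S) (hh : ContMDiffOn 𝓘(ℝ, G) I ∞ h T)
    (heq : ∀ y ∈ T, f (g y) = h y)
    (hinj : Function.Injective (mfderivWithin 𝓘(ℝ, E) I f S (g x)))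
    (hgc : MapsTo g T (chartAt E (g x)).source)
    (hfc : MapsTo f S (chartAt H' (f (g x))).source) :
    ContMDiffWithinAt 𝓘(ℝ, G) 𝓘(ℝ, E) ∞ g T x := by
  set c := extChartAt 𝓘(ℝ, E) (g x) with hc
  have hgs (y) (hy : y ∈ T) : g y ∈ c.source := extChartAt_source 𝓘(ℝ, E) (g x) ▸ hgc hy
  have hmaps : MapsTo (c ∘ g) T (c.target ∩ c.symm ⁻¹' S) := fun y hy ↦
    ⟨c.map_source (hgs y hy), by simpa [c.left_inv (hgs y hy)] using hgT hy⟩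
  have hF : ContDiffOn ℝ ∞ (writtenInExtChartAt 𝓘(ℝ, E) I (g x) f)
      (c.target ∩ c.symm ⁻¹' S) :=
    (contMDiffOn_extChartAt.comp (hf.comp ((contMDiffOn_extChartAt_symm (g x)).mono
      inter_subset_left) fun z hz ↦ hz.2) fun z hz ↦ hfc hz.2).contDiffOn
  have hh' : ContDiffOn ℝ ∞ (extChartAt I (f (g x)) ∘ h) T :=
    (contMDiffOn_extChartAt.comp hh fun y hy ↦
      show h y ∈ _ from heq y hy ▸ hfc (hgT hy)).contDiffOn
  have hcg : ContDiffWithinAt ℝ ∞ (c ∘ g) T x :=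
    contDiffWithinAt_of_comp_immersion hx (hS.uniqueDiffOn_target_inter (g x)) hT hF
      ((continuousOn_extChartAt (g x)).comp hg hgs) hmaps hh'
      (fun y hy ↦ by
        simp only [writtenInExtChartAt, Function.comp_apply, ← hc, c.left_inv (hgs y hy), heq y hy])
      (injective_fderivWithin_writtenInExtChartAt
        ((hf _ (hgT hx)).mdifferentiableWithinAt (by simp)) hinj)
  have hsymm : ContMDiffWithinAt 𝓘(ℝ, G) 𝓘(ℝ, E) ∞ (c.symm ∘ c ∘ g) T x :=
    (contMDiffOn_extChartAt_symm (g x) _ (c.map_source (hgs x hx))).comp x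
      hcg.contMDiffWithinAt fun y hy ↦ (hmaps hy).1
  exact hsymm.congr (fun y hy ↦ (c.left_inv (hgs y hy)).symm) (c.left_inv (hgs x hx)).symm

theorem contMDiffOn_of_comp_immersion (hS : UniqueMDiffOn 𝓘(ℝ, E) S) (hT : UniqueDiffOn ℝ T)
    (hf : ContMDiffOn 𝓘(ℝ, E) I ∞ f S)
    (hinj : ∀ y ∈ S, Function.Injective (mfderivWithin 𝓘(ℝ, E) I f S y))
    (hg : ContinuousOn g T) (hgT : MapsTo g T S) (hh : ContMDiffOn 𝓘(ℝ, G) I ∞ h T)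
    (heq : ∀ y ∈ T, f (g y) = h y) : ContMDiffOn 𝓘(ℝ, G) 𝓘(ℝ, E) ∞ g T := by
  intro x hx
  obtain ⟨u, hu, hxu, hfu⟩ := mem_nhdsWithin.1 <| (hf.continuousOn _ (hgT hx)).eventually_mem
    ((chartAt H' (f (g x))).open_source.mem_nhds (mem_chart_source H' (f (g x))))
  obtain ⟨v, hv, hxv, hgv⟩ := mem_nhdsWithin.1 <| (hg x hx).eventually_mem
    (((chartAt E (g x)).open_source.inter hu).mem_nhds ⟨mem_chart_source E (g x), hxu⟩)
  refine (contMDiffWithinAt_of_comp_immersion_of_mapsTo (S := S ∩ u) (T := T ∩ v) ⟨hx, hxv⟩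
    (hS.inter hu) (hT.inter hv) (hf.mono inter_subset_left) (hg.mono inter_subset_left)
    (fun y hy ↦ ⟨hgT hy.1, (hgv hy.symm).2⟩) (hh.mono inter_subset_left)
    (fun y hy ↦ heq y hy.1) ?_ (fun y hy ↦ (hgv hy.symm).1)
    fun y hy ↦ hfu hy.symm).mono_of_mem_nhdsWithin (inter_mem_nhdsWithin _ (hv.mem_nhds hxv))
  rw [mfderivWithin_inter (hu.mem_nhds hxu)]
  exact hinj _ (hgT hx)

end ManifoldImmersion

/-! ### Normal frames -/

section Along

variable {E H M E' H' N : Type*}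
  [NormedAddCommGroup E] [NormedSpace ℝ E] [TopologicalSpace H]
  [TopologicalSpace M] [ChartedSpace H M]
  [NormedAddCommGroup E'] [NormedSpace ℝ E'] [TopologicalSpace H']
  [TopologicalSpace N] [ChartedSpace H' N]
  {J : ModelWithCorners ℝ E H} {I : ModelWithCorners ℝ E' H'} [IsManifold I ∞ N]
  {f : M → N} {U V : M → E'} {S T : Set M}

/-- `V` is a smooth vector field along `f` on `S`. Tangent vectors of `N` are regarded as elements
of the model space, to which all tangent spaces are definitionally equal. -/
def SmoothAlong (J : ModelWithCorners ℝ E H) (I : ModelWithCorners ℝ E' H') [IsManifold I ∞ N]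
    (f : M → N) (V : M → E') (S : Set M) : Prop :=
  ContMDiffOn J I.tangent ∞ (fun x ↦ (⟨f x, V x⟩ : TangentBundle I N)) S

/-- The coordinates of tangent vectors at `q` in the trivialization of the tangent bundle
at `p`. -/
noncomputable def tangentCoord (I : ModelWithCorners ℝ E' H') [IsManifold I ∞ N] (p q : N) :
    E' →L[ℝ] E' :=
  (trivializationAt E' (TangentSpace I) p).continuousLinearMapAt ℝ q

/-- The inverse of `tangentCoord`. -/
noncomputable def tangentCoordSymm (I : ModelWithCorners ℝ E' H') [IsManifold I ∞ N] (p q : N) :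
    E' →L[ℝ] E' :=
  (trivializationAt E' (TangentSpace I) p).symmL ℝ q

theorem tangentCoordSymm_tangentCoord {p q : N} (hq : q ∈ (chartAt H' p).source) (v : E') :
    tangentCoordSymm I p q (tangentCoord I p q v) = v :=
  (trivializationAt E' (TangentSpace I) p).symmL_continuousLinearMapAt (R := ℝ) hq v

theorem tangentCoord_tangentCoordSymm {p q : N} (hq : q ∈ (chartAt H' p).source) (v : E') :
    tangentCoord I p q (tangentCoordSymm I p q v) = v :=
  (trivializationAt E' (TangentSpace I) p).continuousLinearMapAt_symmL (R := ℝ) hq v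

theorem isInvertible_tangentCoord {p q : N} (hq : q ∈ (chartAt H' p).source) :
    (tangentCoord I p q).IsInvertible :=
  .of_inverse (ContinuousLinearMap.ext fun v ↦ tangentCoord_tangentCoordSymm hq v)
    (ContinuousLinearMap.ext fun v ↦ tangentCoordSymm_tangentCoord hq v)

theorem eventually_mem_chartAt_source {x : M} (hf : ContinuousWithinAt f S x) :
    ∀ᶠ y in 𝓝[S] x, f y ∈ (chartAt H' (f x)).source :=
  hf.eventually_mem ((chartAt H' (f x)).open_source.mem_nhds (mem_chart_source H' (f x)))

theorem contMDiffWithinAt_along_iff {x : M} (hx : x ∈ S) (hf : ContMDiffWithinAt J I ∞ f S x) :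
    ContMDiffWithinAt J I.tangent ∞ (fun y ↦ (⟨f y, V y⟩ : TangentBundle I N)) S x ↔
      ContMDiffWithinAt J 𝓘(ℝ, E') ∞ (fun y ↦ tangentCoord I (f x) (f y) (V y)) S x := by
  have heq : (fun y ↦ (trivializationAt E' (TangentSpace I) (f x)
      (⟨f y, V y⟩ : TangentBundle I N)).2) =ᶠ[𝓝[S] x]
        fun y ↦ tangentCoord I (f x) (f y) (V y) := by
    filter_upwards [eventually_mem_chartAt_source (H' := H') hf.continuousWithinAt] with y hy
    exact (congrFun ((trivializationAt E' (TangentSpace I) (f x)).coe_linearMapAt_of_mem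
      (R := ℝ) hy) (V y)).symm
  rw [contMDiffWithinAt_totalSpace, and_iff_right hf]
  exact heq.contMDiffWithinAt_iff (heq.self_of_nhdsWithin hx)

theorem SmoothAlong.contMDiffOn (h : SmoothAlong J I f V S) : ContMDiffOn J I ∞ f S :=
  fun x hx ↦ (contMDiffWithinAt_totalSpace.1 (h x hx)).1

theorem SmoothAlong.mono (h : SmoothAlong J I f V S) (hT : T ⊆ S) : SmoothAlong J I f V T :=
  ContMDiffOn.mono h hT

theorem SmoothAlong.congr {f' : M → N} (h : SmoothAlong J I f V S) (hf : EqOn f' f S)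
    (hU : EqOn U V S) : SmoothAlong J I f' U S :=
  ContMDiffOn.congr h fun x hx ↦ by
    rw [hU hx]
    exact congrArg (fun p ↦ (⟨p, V x⟩ : TangentBundle I N)) (hf hx)

theorem SmoothAlong.add (hU : SmoothAlong J I f U S) (hV : SmoothAlong J I f V S) :
    SmoothAlong J I f (fun x ↦ U x + V x) S := by
  intro x hx
  have hf := hV.contMDiffOn x hx
  refine (contMDiffWithinAt_along_iff hx hf).2 ?_
  simp only [map_add]
  exact ((contMDiffWithinAt_along_iff hx hf).1 (hU x hx)).add
    ((contMDiffWithinAt_along_iff hx hf).1 (hV x hx))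

theorem SmoothAlong.smul {a : M → ℝ} (ha : ContMDiffOn J 𝓘(ℝ, ℝ) ∞ a S)
    (hV : SmoothAlong J I f V S) : SmoothAlong J I f (fun x ↦ a x • V x) S := by
  intro x hx
  have hf := hV.contMDiffOn x hx
  refine (contMDiffWithinAt_along_iff hx hf).2 ?_
  simp only [map_smul]
  exact (ha x hx).smul ((contMDiffWithinAt_along_iff hx hf).1 (hV x hx))

theorem smoothAlong_zero (hf : ContMDiffOn J I ∞ f S) : SmoothAlong J I f (fun _ ↦ 0) S := by
  intro x hx
  refine (contMDiffWithinAt_along_iff hx (hf x hx)).2 ?_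
  simp only [map_zero]
  exact contMDiffWithinAt_const

theorem SmoothAlong.sum {κ : Type*} (hf : ContMDiffOn J I ∞ f S) (s : Finset κ)
    {V : κ → M → E'} (hV : ∀ i ∈ s, SmoothAlong J I f (V i) S) :
    SmoothAlong J I f (fun x ↦ ∑ i ∈ s, V i x) S := by
  classical
  induction s using Finset.induction_on with
  | empty => simpa only [Finset.sum_empty] using smoothAlong_zero hf
  | insert i s hi ih =>
    simp only [Finset.sum_insert hi]
    exact (hV i (s.mem_insert_self i)).add (ih fun j hj ↦ hV j (Finset.mem_insert_of_mem hj))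

theorem smoothAlong_tangentCoordSymm {p : N} (hf : ContMDiffOn J I ∞ f S)
    (hS : MapsTo f S (chartAt H' p).source) (w : E') :
    SmoothAlong J I f (fun x ↦ tangentCoordSymm I p (f x) w) S := by
  have : IsManifold I (∞ + 1) N := inferInstanceAs (IsManifold I ∞ N)
  refine (Trivialization.contMDiffOn_iff (IB := I) (n := ∞)
    (e := trivializationAt E' (TangentSpace I) p) fun x hx ↦
      by exact (Trivialization.mem_source _).2 (hS hx)).2
    ⟨hf, (contMDiffOn_const (c := w)).congr fun x hx ↦ ?_⟩
  exact (congrFun ((trivializationAt E' (TangentSpace I) p).coe_linearMapAt_of_mem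
    (R := ℝ) (hS hx)) _).symm.trans (tangentCoord_tangentCoordSymm (hS hx) w)

theorem SmoothAlong.comp {E'' H'' M' : Type*} [NormedAddCommGroup E''] [NormedSpace ℝ E'']
    [TopologicalSpace H''] [TopologicalSpace M'] [ChartedSpace H'' M']
    {J' : ModelWithCorners ℝ E'' H''} {g : M' → M} {T : Set M'} (h : SmoothAlong J I f V S)
    (hg : ContMDiffOn J' J ∞ g T) (hgT : MapsTo g T S) :
    SmoothAlong J' I (f ∘ g) (V ∘ g) T :=
  ContMDiffOn.comp (t := S) h hg hgT

theorem smoothAlong_vectorSpace_iff {g V : M → E'} :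
    SmoothAlong J 𝓘(ℝ, E') g V S ↔
      ContMDiffOn J 𝓘(ℝ, E') ∞ g S ∧ ContMDiffOn J 𝓘(ℝ, E') ∞ V S := by
  refine ⟨fun h ↦ ⟨h.contMDiffOn,
    (contMDiff_snd_tangentBundle_modelSpace E' 𝓘(ℝ, E')).comp_contMDiffOn h⟩,
    fun ⟨hg, hV⟩ x hx ↦ contMDiffWithinAt_totalSpace.2 ⟨hg x hx, ?_⟩⟩
  convert! hV x hx with y
  simp

/-- The differential of `f : S → N`, as a map between the model spaces. -/
noncomputable def differential (J : ModelWithCorners ℝ E H) (I : ModelWithCorners ℝ E' H')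
    (f : M → N) (S : Set M) (x : M) : E →L[ℝ] E' :=
  mfderivWithin J I f S x

theorem SmoothAlong.map_differential [IsManifold J ∞ M] {E'' H'' M' : Type*}
    [NormedAddCommGroup E''] [NormedSpace ℝ E''] [TopologicalSpace H''] [TopologicalSpace M']
    [ChartedSpace H'' M'] {J' : ModelWithCorners ℝ E'' H''} {g : M' → M} {X : M' → E}
    {T : Set M'} (hf : ContMDiffOn J I ∞ f S) (hS : UniqueMDiffOn J S)
    (hX : SmoothAlong J' J g X T) (hg : MapsTo g T S) :
    SmoothAlong J' I (f ∘ g) (fun x ↦ differential J I f S (g x) (X x)) T := by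
  have : IsManifold J 1 M := .of_le (n := ∞) (by simp)
  have : IsManifold I 1 N := .of_le (n := ∞) (by simp)
  exact ContMDiffOn.comp (hf.contMDiffOn_tangentMapWithin (m := ∞) le_rfl hS) hX
    fun x hx ↦ hg hx

end Along

section NormalFrame

variable {κ E H M E' H' N : Type*} [Fintype κ]
  [NormedAddCommGroup E] [NormedSpace ℝ E] [TopologicalSpace H]
  [TopologicalSpace M] [ChartedSpace H M]
  [NormedAddCommGroup E'] [NormedSpace ℝ E'] [TopologicalSpace H']
  [TopologicalSpace N] [ChartedSpace H' N]
  {J : ModelWithCorners ℝ E H} {I : ModelWithCorners ℝ E' H'}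
  {f : M → N} {S T : Set M} {V V' : κ → M → E'} {x : M}

/-- The map `ℝ^κ × T_x S → T_{f x} N` given by the fields `V i` along `f` and the differential
of `f`. -/
noncomputable def frameMap (J : ModelWithCorners ℝ E H) (I : ModelWithCorners ℝ E' H')
    (f : M → N) (S : Set M) (V : κ → M → E') (x : M) : (κ → ℝ) × E →L[ℝ] E' :=
  (Fintype.linearCombination ℝ fun i ↦ V i x).toContinuousLinearMap.coprod
    (differential J I f S x)

theorem frameMap_apply (x : M) (p : (κ → ℝ) × E) :
    frameMap J I f S V x p = ∑ i, p.1 i • V i x + differential J I f S x p.2 := by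
  simp [frameMap, Fintype.linearCombination_apply]

theorem injective_frameMap_iff :
    Function.Injective (frameMap J I f S V x) ↔ Function.Injective (differential J I f S x) ∧
      ∀ (c : κ → ℝ) (v : E), ∑ i, c i • V i x = differential J I f S x v → c = 0 := by
  simp only [injective_iff_map_eq_zero, Prod.forall, frameMap_apply, Prod.mk_eq_zero]
  refine ⟨fun h ↦ ⟨fun v hv ↦ (h 0 v (by simpa using hv)).2,
    fun c v hc ↦ (h c (-v) (by simp [hc])).1⟩, fun ⟨hf, hV⟩ c v hcv ↦ ?_⟩
  obtain rfl : c = 0 := hV c (-v) (by rw [map_neg, ← add_eq_zero_iff_eq_neg, hcv])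
  exact ⟨rfl, hf v (by simpa using hcv)⟩

theorem bijective_frameMap_of_injective [FiniteDimensional ℝ E] [FiniteDimensional ℝ E']
    (hdim : Fintype.card κ + Module.finrank ℝ E = Module.finrank ℝ E')
    (h : Function.Injective (frameMap J I f S V x)) :
    Function.Bijective (frameMap J I f S V x) :=
  ⟨h, (LinearMap.injective_iff_surjective_of_finrank_eq_finrank
    (f := (frameMap J I f S V x).toLinearMap) (by simpa using hdim)).1 h⟩

theorem isInvertible_of_bijective {E F : Type*} [NormedAddCommGroup E] [NormedSpace ℝ E]
    [NormedAddCommGroup F] [NormedSpace ℝ F] [FiniteDimensional ℝ E] {A : E →L[ℝ] F}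
    (hA : Function.Bijective A) : A.IsInvertible :=
  ⟨(LinearEquiv.ofBijective A.toLinearMap hA).toContinuousLinearEquiv, by ext; rfl⟩

variable [IsManifold I ∞ N]

/-- `V` is a smooth framing over `T ⊆ S` of the normal bundle of the immersion `f : S → N`: a family
of vector fields along `f` that is a basis of `T_{f x} N` modulo the image of the differential. -/
structure IsNormalFrame (J : ModelWithCorners ℝ E H) (I : ModelWithCorners ℝ E' H')
    [IsManifold I ∞ N] (f : M → N) (S T : Set M) (V : κ → M → E') : Prop where
  smooth : ∀ i, SmoothAlong J I f (V i) T
  bijective : ∀ x ∈ T, Function.Bijective (frameMap J I f S V x)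

theorem IsNormalFrame.eq_zero (h : IsNormalFrame J I f S T V) (hx : x ∈ T) {c : κ → ℝ} {v : E}
    (hc : ∑ i, c i • V i x = differential J I f S x v) : c = 0 :=
  (injective_frameMap_iff.1 (h.bijective x hx).1).2 c v hc

theorem IsNormalFrame.congr (h : IsNormalFrame J I f S T V) (hV : ∀ x ∈ T, ∀ i, V' i x = V i x) :
    IsNormalFrame J I f S T V' where
  smooth i := (h.smooth i).congr (eqOn_refl f T) fun x hx ↦ hV x hx i
  bijective x hx := by
    have := h.bijective x hx
    simpa only [frameMap, hV x hx] using this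

theorem IsNormalFrame.of_locally
    (h : ∀ x ∈ T, ∃ u, IsOpen u ∧ x ∈ u ∧ IsNormalFrame J I f S (T ∩ u) V) :
    IsNormalFrame J I f S T V where
  smooth i := contMDiffOn_of_locally_contMDiffOn fun x hx ↦
    let ⟨u, hu, hxu, hV⟩ := h x hx
    ⟨u, hu, hxu, hV.smooth i⟩
  bijective x hx :=
    let ⟨_, _, hxu, hV⟩ := h x hx
    hV.bijective x ⟨hx, hxu⟩

theorem IsNormalFrame.changeBasis [DecidableEq κ] (h : IsNormalFrame J I f S T V)
    (C : (κ → ℝ) ≃ₗ[ℝ] (κ → ℝ)) :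
    IsNormalFrame J I f S T fun i x ↦ ∑ j, C (Pi.single i 1) j • V j x where
  smooth i := SmoothAlong.sum (h.smooth i).contMDiffOn _ fun j _ ↦
    SmoothAlong.smul contMDiffOn_const (h.smooth j)
  bijective x hx := by
    have heq (p : (κ → ℝ) × E) : frameMap J I f S (fun i x ↦ ∑ j, C (Pi.single i 1) j • V j x) x p =
        frameMap J I f S V x (C p.1, p.2) := by
      have hC (j) : C p.1 j = ∑ i, p.1 i * C (Pi.single i 1) j := by
        conv_lhs => rw [← Finset.univ_sum_single p.1]
        simp only [map_sum, Finset.sum_apply]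
        refine Finset.sum_congr rfl fun i _ ↦ ?_
        rw [← mul_one (p.1 i), ← smul_eq_mul (p.1 i) 1, Pi.single_smul, map_smul]
        simp
      simp only [frameMap_apply, hC, Finset.smul_sum, Finset.sum_smul, smul_smul]
      rw [Finset.sum_comm]
    rw [funext heq]
    exact (h.bijective x hx).comp (C.bijective.prodMap Function.bijective_id)

section Comp

variable {E'' H'' M' : Type*} [NormedAddCommGroup E''] [NormedSpace ℝ E'']
  [TopologicalSpace H''] [TopologicalSpace M'] [ChartedSpace H'' M']
  {J' : ModelWithCorners ℝ E'' H''} {f' : M' → N} {g : M' → M} {S' T' : Set M'} {x : M'}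

theorem IsNormalFrame.comp (h : IsNormalFrame J I f S T V) (hg : ContMDiffOn J' J ∞ g T')
    (hgT : MapsTo g T' T) (hfg : EqOn f' (f ∘ g) T') (D : M' → E'' →L[ℝ] E)
    (hD : ∀ x ∈ T', Function.Bijective (D x))
    (hd : ∀ x ∈ T', differential J' I f' S' x = differential J I f S (g x) ∘L D x) :
    IsNormalFrame J' I f' S' T' fun i x ↦ V i (g x) where
  smooth i := ((h.smooth i).comp hg hgT).congr hfg fun _ _ ↦ rfl
  bijective x hx := by
    have heq (p : (κ → ℝ) × E'') : frameMap J' I f' S' (fun i x ↦ V i (g x)) x p =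
        frameMap J I f S V (g x) (p.1, D x p.2) := by
      simp only [frameMap_apply, hd x hx, ContinuousLinearMap.comp_apply]
    rw [funext heq]
    exact (h.bijective _ (hgT hx)).comp (Function.bijective_id.prodMap (hD x hx))

end Comp

theorem IsNormalFrame.postcomp {F H'' P : Type*} [NormedAddCommGroup F] [NormedSpace ℝ F]
    [TopologicalSpace H''] [TopologicalSpace P] [ChartedSpace H'' P]
    {I' : ModelWithCorners ℝ F H''} [IsManifold I' ∞ P] {Ψ : N → P} {U : Set N} {f' : M → P}
    (h : IsNormalFrame J I f S T V) (hΨ : ContMDiffOn I I' ∞ Ψ U) (hU : UniqueMDiffOn I U)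
    (hfU : MapsTo f T U) (hbij : ∀ y ∈ U, Function.Bijective (differential I I' Ψ U y))
    (hf' : EqOn f' (Ψ ∘ f) T)
    (hd : ∀ x ∈ T, differential J I' f' S x =
      differential I I' Ψ U (f x) ∘L differential J I f S x) :
    IsNormalFrame J I' f' S T fun i x ↦ differential I I' Ψ U (f x) (V i x) where
  smooth i := (SmoothAlong.map_differential hΨ hU (h.smooth i) hfU).congr hf' fun _ _ ↦ rfl
  bijective x hx := by
    have heq (p : (κ → ℝ) × E) :
        frameMap J I' f' S (fun i x ↦ differential I I' Ψ U (f x) (V i x)) x p =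
          differential I I' Ψ U (f x) (frameMap J I f S V x p) := by
      simp only [frameMap_apply, hd x hx, ContinuousLinearMap.comp_apply, map_add, map_sum,
        map_smul]
    rw [funext heq]
    exact (hbij _ (hfU hx)).comp (h.bijective x hx)

end NormalFrame

section Differential

variable {E H M E' H' N E'' H'' M' : Type*}
  [NormedAddCommGroup E] [NormedSpace ℝ E] [TopologicalSpace H]
  [TopologicalSpace M] [ChartedSpace H M]
  [NormedAddCommGroup E'] [NormedSpace ℝ E'] [TopologicalSpace H']
  [TopologicalSpace N] [ChartedSpace H' N]
  [NormedAddCommGroup E''] [NormedSpace ℝ E''] [TopologicalSpace H'']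
  [TopologicalSpace M'] [ChartedSpace H'' M']
  {J : ModelWithCorners ℝ E H} {I : ModelWithCorners ℝ E' H'} {J' : ModelWithCorners ℝ E'' H''}
  {f : M → N} {g : M' → M} {h : M' → N} {S u : Set M} {T : Set M'}

theorem differential_inter {x : M} (hu : IsOpen u) (hx : x ∈ u) :
    differential J I f (S ∩ u) x = differential J I f S x :=
  mfderivWithin_inter (hu.mem_nhds hx)

theorem differential_eq_fderivWithin {f : E → E'} {S : Set E} {x : E} :
    differential 𝓘(ℝ, E) 𝓘(ℝ, E') f S x = fderivWithin ℝ f S x :=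
  mfderivWithin_eq_fderivWithin

theorem differential_eq_comp {x : M'} (hf : ContMDiffOn J I ∞ f S) (hg : ContMDiffOn J' J ∞ g T)
    (hT : UniqueMDiffOn J' T) (hgT : MapsTo g T S) (heq : EqOn h (f ∘ g) T) (hx : x ∈ T) :
    differential J' I h T x = differential J I f S (g x) ∘L differential J' J g T x :=
  (mfderivWithin_congr heq (heq hx)).trans <|
    mfderivWithin_comp x ((hf _ (hgT hx)).mdifferentiableWithinAt (by simp))
      ((hg x hx).mdifferentiableWithinAt (by simp)) hgT (hT x hx)

end Differential

section LocalFrame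

theorem exists_linearIndependent_mod_range {κ E E' : Type*} [Fintype κ]
    [NormedAddCommGroup E] [NormedSpace ℝ E] [NormedAddCommGroup E'] [NormedSpace ℝ E']
    [FiniteDimensional ℝ E'] {A : E →L[ℝ] E'}
    (hdim : Fintype.card κ + Module.finrank ℝ E = Module.finrank ℝ E')
    (hA : Function.Injective A) :
    ∃ w : κ → E', ∀ (c : κ → ℝ) (v : E), ∑ i, c i • w i = A v → c = 0 := by
  obtain ⟨p, hp⟩ := LinearMap.exists_leftInverse_of_injective A.toLinearMap
    (LinearMap.ker_eq_bot.2 hA)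
  have hpA (v : E) : p (A v) = v := LinearMap.congr_fun hp v
  have hker : Module.finrank ℝ (LinearMap.ker p) = Fintype.card κ := by
    have := p.finrank_range_add_finrank_ker
    rw [LinearMap.range_eq_top.2 fun v ↦ ⟨A v, hpA v⟩, finrank_top] at this
    omega
  let w := Module.finBasisOfFinrankEq ℝ (LinearMap.ker p) hker |>.reindex (Fintype.equivFin κ).symm
  refine ⟨fun i ↦ w i, fun c v hcv ↦ ?_⟩
  have hv : v = 0 := by
    rw [← hpA v, ← hcv, map_sum]
    exact Finset.sum_eq_zero fun i _ ↦ by rw [map_smul, (w i).2, smul_zero]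
  have hsum : ∑ i, c i • w i = 0 := Subtype.ext (by simpa [hv] using hcv)
  exact funext (Fintype.linearIndependent_iff.1 w.linearIndependent c hsum)

variable {κ E E' H' N : Type*} [Fintype κ]
  [NormedAddCommGroup E] [NormedSpace ℝ E] [FiniteDimensional ℝ E]
  [NormedAddCommGroup E'] [NormedSpace ℝ E'] [TopologicalSpace H']
  [TopologicalSpace N] [ChartedSpace H' N]
  {I : ModelWithCorners ℝ E' H'}
  {f : E → N} {S T : Set E} {V : κ → E → E'} {x : E}

theorem contDiffWithinAt_clm_of_forall_apply {D : Type*} [NormedAddCommGroup D] [NormedSpace ℝ D]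
    {n : ℕ∞ω} {A : D → E →L[ℝ] E'} {s : Set D} {x : D}
    (h : ∀ v, ContDiffWithinAt ℝ n (fun y ↦ A y v) s x) : ContDiffWithinAt ℝ n A s x := by
  let b := Module.finBasis ℝ E
  have hA : A = fun y ↦ ∑ i, (b.coord i).toContinuousLinearMap.smulRight (A y (b i)) := by
    ext y v
    conv_lhs => rw [← b.sum_repr v, map_sum]
    simp
  rw [hA]
  exact ContDiffWithinAt.sum fun i _ ↦ contDiffWithinAt_const.smulRight (h (b i))

variable [IsManifold I ∞ N]

theorem contDiffWithinAt_tangentCoord_comp_frameMap (hf : ContMDiffOn 𝓘(ℝ, E) I ∞ f S)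
    (hS : UniqueDiffOn ℝ S) (hTS : T ⊆ S) (hV : ∀ i, SmoothAlong 𝓘(ℝ, E) I f (V i) T)
    (hx : x ∈ T) :
    ContDiffWithinAt ℝ ∞
      (fun y ↦ tangentCoord I (f x) (f y) ∘L frameMap 𝓘(ℝ, E) I f S V y) T x := by
  refine contDiffWithinAt_clm_of_forall_apply fun p ↦ ?_
  have hp : SmoothAlong 𝓘(ℝ, E) I f (fun y ↦ frameMap 𝓘(ℝ, E) I f S V y p) T := by
    simp only [frameMap_apply]
    exact (SmoothAlong.sum (hf.mono hTS) _ fun i _ ↦ (hV i).smul contMDiffOn_const).add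
      ((smoothAlong_vectorSpace_iff.2 ⟨contMDiffOn_id, contMDiffOn_const⟩).map_differential hf
        hS.uniqueMDiffOn hTS)
  exact ((contMDiffWithinAt_along_iff hx (hf.mono hTS x hx)).1 (hp x hx)).contDiffWithinAt

theorem IsNormalFrame.contDiffOn_inverse {U : E → E'} (h : IsNormalFrame 𝓘(ℝ, E) I f S T V)
    (hf : ContMDiffOn 𝓘(ℝ, E) I ∞ f S) (hS : UniqueDiffOn ℝ S) (hTS : T ⊆ S)
    (hU : SmoothAlong 𝓘(ℝ, E) I f U T) :
    ContDiffOn ℝ ∞ (fun x ↦ (frameMap 𝓘(ℝ, E) I f S V x).inverse (U x)) T := by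
  intro x hx
  have hC := contDiffWithinAt_tangentCoord_comp_frameMap hf hS hTS h.smooth hx
  have hCU := ((contMDiffWithinAt_along_iff hx (hf.mono hTS x hx)).1 (hU x hx)).contDiffWithinAt
  have hCinv : ContDiffWithinAt ℝ ∞ (fun y ↦
      (tangentCoord I (f x) (f y) ∘L frameMap 𝓘(ℝ, E) I f S V y).inverse) T x := by
    obtain ⟨e, he⟩ := (isInvertible_tangentCoord (I := I) (mem_chart_source H' (f x))).comp
      (isInvertible_of_bijective (h.bijective x hx))
    have : CompleteSpace ((κ → ℝ) × E) := FiniteDimensional.complete ℝ _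
    exact ContDiffAt.comp_contDiffWithinAt x
      (he ▸ contDiffAt_map_inverse (𝕜 := ℝ) e) hC
  have heq : (fun y ↦ (frameMap 𝓘(ℝ, E) I f S V y).inverse (U y)) =ᶠ[𝓝[T] x] fun y ↦
      (tangentCoord I (f x) (f y) ∘L frameMap 𝓘(ℝ, E) I f S V y).inverse
        (tangentCoord I (f x) (f y) (U y)) := by
    filter_upwards [eventually_mem_chartAt_source (H' := H')
      (hf.mono hTS x hx).continuousWithinAt] with y hy
    obtain ⟨e, he⟩ := isInvertible_tangentCoord (I := I) hy
    simp [← he]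
  exact (hCinv.clm_apply hCU).congr_of_eventuallyEq heq (heq.self_of_nhdsWithin hx)

theorem eventually_bijective_frameMap (hf : ContMDiffOn 𝓘(ℝ, E) I ∞ f S)
    (hS : UniqueDiffOn ℝ S) (hTS : T ⊆ S) (hV : ∀ i, SmoothAlong 𝓘(ℝ, E) I f (V i) T)
    (hx : x ∈ T) (hbij : Function.Bijective (frameMap 𝓘(ℝ, E) I f S V x)) :
    ∀ᶠ y in 𝓝[T] x, Function.Bijective (frameMap 𝓘(ℝ, E) I f S V y) := by
  have hinv := (isInvertible_tangentCoord (I := I) (mem_chart_source H' (f x))).comp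
    (isInvertible_of_bijective hbij)
  have hcont := (contDiffWithinAt_tangentCoord_comp_frameMap hf hS hTS hV hx).continuousWithinAt
  have hopen : {A : (κ → ℝ) × E →L[ℝ] E' | A.IsInvertible} ∈
      𝓝 (tangentCoord I (f x) (f x) ∘L frameMap 𝓘(ℝ, E) I f S V x) := by
    obtain ⟨e, he⟩ := hinv
    exact he ▸ ContinuousLinearEquiv.nhds e
  filter_upwards [hcont.eventually_mem hopen, eventually_mem_chartAt_source (H' := H')
    (hf.mono hTS x hx).continuousWithinAt] with y hy hfy
  refine (Function.Bijective.of_comp_iff' (isInvertible_tangentCoord (I := I) hfy).bijective _).1 ?_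
  rw [← ContinuousLinearMap.coe_comp]
  exact hy.bijective

theorem exists_isNormalFrame_nhds [FiniteDimensional ℝ E']
    (hdim : Fintype.card κ + Module.finrank ℝ E = Module.finrank ℝ E')
    (hf : ContMDiffOn 𝓘(ℝ, E) I ∞ f S) (hS : UniqueDiffOn ℝ S) (hx : x ∈ S)
    (hinj : Function.Injective (differential 𝓘(ℝ, E) I f S x)) :
    ∃ (u : Set E) (V : κ → E → E'), IsOpen u ∧ x ∈ u ∧
      IsNormalFrame 𝓘(ℝ, E) I f S (S ∩ u) V := by
  obtain ⟨w, hw⟩ := exists_linearIndependent_mod_range (κ := κ) hdim hinj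
  obtain ⟨u₁, hu₁, hxu₁, hfu₁⟩ := mem_nhdsWithin.1 <|
    eventually_mem_chartAt_source (H' := H') (hf x hx).continuousWithinAt
  let V (i : κ) (y : E) : E' :=
    tangentCoordSymm I (f x) (f y) (tangentCoord I (f x) (f x) (w i))
  have hV (i) : SmoothAlong 𝓘(ℝ, E) I f (V i) (S ∩ u₁) :=
    smoothAlong_tangentCoordSymm (hf.mono inter_subset_left) (fun y hy ↦ hfu₁ hy.symm) _
  have hVx (i) : V i x = w i := tangentCoordSymm_tangentCoord (mem_chart_source H' (f x)) (w i)
  have hbij : Function.Bijective (frameMap 𝓘(ℝ, E) I f S V x) :=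
    bijective_frameMap_of_injective hdim <|
      injective_frameMap_iff.2 ⟨hinj, by simpa only [hVx] using hw⟩
  obtain ⟨u₂, hu₂, hxu₂, hu₂V⟩ := mem_nhdsWithin.1 <|
    eventually_bijective_frameMap hf hS inter_subset_left hV ⟨hx, hxu₁⟩ hbij
  exact ⟨u₁ ∩ u₂, V, hu₁.inter hu₂, ⟨hxu₁, hxu₂⟩,
    fun i ↦ (hV i).mono (by gcongr; exact inter_subset_left),
    fun y hy ↦ hu₂V ⟨hy.2.2, hy.1, hy.2.1⟩⟩

end LocalFrame

/-! ### Normal frames over star-convex sets -/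

section StarConvex

theorem eq_zero_of_apply_eq_zero_of_norm_sub_lt_one {X : Type*} [NormedAddCommGroup X]
    [NormedSpace ℝ X] {P Q : X →L[ℝ] X} {w : X} (hPQ : ‖P - Q‖ < 1) (hP : P w = w)
    (hQ : Q w = 0) : w = 0 := by
  by_contra hw
  have h : ‖w‖ ≤ ‖P - Q‖ * ‖w‖ := by
    simpa [hP, hQ] using (P - Q).le_opNorm w
  nlinarith [norm_pos_iff.2 hw]

variable {E X : Type*} [NormedAddCommGroup E] [NormedSpace ℝ E]
  [NormedAddCommGroup X] [NormedSpace ℝ X] {S : Set E} {a : E} {Q : E → X →L[ℝ] X}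

/-- Moving from `a` to `x` along the segment in steps so short that `Q` varies by less than `1` in
each of them, the product of the projections passed is injective on the image of `Q a`. -/
theorem exists_contDiffOn_injOn_of_isIdempotentElem (hS : IsCompact S) (hSa : StarConvex ℝ a S)
    (hQ : ContDiffOn ℝ ∞ Q S) (hidem : ∀ x ∈ S, ∀ w, Q x (Q x w) = Q x w) :
    ∃ F : E → X →L[ℝ] X, ContDiffOn ℝ ∞ F S ∧
      ∀ x ∈ S, ∀ w, Q a w = w → Q x (F x w) = 0 → w = 0 := by
  obtain ⟨δ, hδ, hQδ⟩ := Metric.uniformContinuousOn_iff.1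
    (hS.uniformContinuousOn_of_continuous hQ.continuousOn) 1 one_pos
  obtain ⟨r, hr⟩ := hS.isBounded.subset_closedBall a
  obtain ⟨n, hn⟩ := exists_nat_gt (r / δ)
  let p (k : ℕ) (x : E) : E := a + (k / (n + 1) : ℝ) • (x - a)
  have hpS {k : ℕ} (hk : k ≤ n + 1) : MapsTo (p k) S S := fun x hx ↦
    hSa.add_smul_sub_mem hx (by positivity) ((div_le_one (by positivity)).2 (by exact_mod_cast hk))
  have hpdist (k : ℕ) {x : E} (hx : x ∈ S) : dist (p k x) (p (k + 1) x) < δ := by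
    have hpp : p k x - p (k + 1) x = (-1 / (n + 1) : ℝ) • (x - a) := by
      simp only [p, Nat.cast_add, Nat.cast_one, add_sub_add_left_eq_sub, ← sub_smul]
      ring_nf
    have hxa : ‖x - a‖ ≤ r := mem_closedBall_iff_norm.1 (hr hx)
    rw [dist_eq_norm, hpp, norm_smul, Real.norm_eq_abs, abs_div, abs_neg, abs_one,
      abs_of_pos (by positivity), div_mul_eq_mul_div, one_mul, div_lt_iff₀ (by positivity)]
    nlinarith [(div_lt_iff₀ hδ).1 hn]
  have hstep (k : ℕ) (hk : k ≤ n + 1) : ∃ F : E → X →L[ℝ] X, ContDiffOn ℝ ∞ F S ∧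
      ∀ x ∈ S, ∀ w, Q a w = w → Q (p k x) (F x w) = F x w ∧ (F x w = 0 → w = 0) := by
    induction k with
    | zero => exact ⟨fun _ ↦ .id ℝ X, contDiffOn_const, fun x _ w hw ↦ by simp [p, hw]⟩
    | succ k ih =>
      obtain ⟨F, hF, hFw⟩ := ih (by omega)
      refine ⟨fun x ↦ Q (p (k + 1) x) ∘L F x,
        (hQ.comp (by fun_prop) (hpS hk)).clm_comp hF, fun x hx w hw ↦ ⟨hidem _ (hpS hk hx) _,
          fun h0 ↦ (hFw x hx w hw).2 <| eq_zero_of_apply_eq_zero_of_norm_sub_lt_one ?_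
            (hFw x hx w hw).1 h0⟩⟩
      rw [← dist_eq_norm]
      exact hQδ _ (hpS (by omega) hx) _ (hpS hk hx) (hpdist k hx)
  obtain ⟨F, hF, hFw⟩ := hstep (n + 1) le_rfl
  refine ⟨F, hF, fun x hx w hw h0 ↦ (hFw x hx w hw).2 ((hFw x hx w hw).1 ▸ ?_)⟩
  have hpx : p (n + 1) x = x := by
    simp [p, div_self (show (n + 1 : ℝ) ≠ 0 by positivity)]
  rwa [hpx]

end StarConvex

section Summand

variable {ι κ α E E' H' N : Type*} [Fintype ι] [Fintype κ] [Fintype α]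
  [NormedAddCommGroup E] [NormedSpace ℝ E]
  [NormedAddCommGroup E'] [NormedSpace ℝ E'] [TopologicalSpace H']
  [TopologicalSpace N] [ChartedSpace H' N]
  {I : ModelWithCorners ℝ E' H'} [IsManifold I ∞ N]
  {f : E → N} {S : Set E}

theorem exists_contDiffOn_sum_sq_eq_one [FiniteDimensional ℝ E] {u : ι → Set E}
    (hS : IsClosed S) (hu : ∀ i, IsOpen (u i)) (hSu : S ⊆ ⋃ i, u i) :
    ∃ ψ : ι → E → ℝ, (∀ i, ContDiffOn ℝ ∞ (ψ i) S) ∧ (∀ i, tsupport (ψ i) ⊆ u i) ∧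
      ∀ x ∈ S, ∑ i, ψ i x ^ 2 = 1 := by
  obtain ⟨ρ, hρ⟩ := SmoothPartitionOfUnity.exists_isSubordinate 𝓘(ℝ, E) hS u hu hSu
  have hpos (x) (hx : x ∈ S) : 0 < ∑ i, ρ i x ^ 2 := by
    obtain ⟨i, hi⟩ := ρ.exists_pos_of_mem hx
    exact Finset.sum_pos' (fun _ _ ↦ sq_nonneg _) ⟨i, Finset.mem_univ i, by positivity⟩
  have hρs (i) : ContDiffOn ℝ ∞ (ρ i) S := (ρ i).contMDiff.contDiff.contDiffOn
  refine ⟨fun i x ↦ ρ i x * (√(∑ k, ρ k x ^ 2))⁻¹, fun i ↦ (hρs i).mul ?_,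
    fun i ↦ (tsupport_mul_subset_left).trans (hρ i), fun x hx ↦ ?_⟩
  · exact ((ContDiffOn.sum fun k _ ↦ (hρs k).pow 2).sqrt fun x hx ↦ (hpos x hx).ne').inv
      fun x hx ↦ (Real.sqrt_pos.2 (hpos x hx)).ne'
  · simp only [mul_pow, inv_pow, Real.sq_sqrt (hpos x hx).le, ← Finset.sum_mul]
    exact mul_inv_cancel₀ (hpos x hx).ne'

theorem SmoothAlong.smul_of_tsupport_subset {ψ : E → ℝ} {V : E → E'} {u : Set E} (hu : IsOpen u)
    (hf : ContMDiffOn 𝓘(ℝ, E) I ∞ f S) (hψ : ContDiffOn ℝ ∞ ψ S) (hψu : tsupport ψ ⊆ u)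
    (hV : SmoothAlong 𝓘(ℝ, E) I f V (S ∩ u)) :
    SmoothAlong 𝓘(ℝ, E) I f (fun x ↦ ψ x • V x) S := by
  refine contMDiffOn_of_locally_contMDiffOn fun x _ ↦ ?_
  by_cases hxu : x ∈ u
  · exact ⟨u, hu, hxu, SmoothAlong.smul (hψ.mono inter_subset_left).contMDiffOn hV⟩
  · refine ⟨(tsupport ψ)ᶜ, (isClosed_tsupport ψ).isOpen_compl, fun h ↦ hxu (hψu h), ?_⟩
    refine (smoothAlong_zero (hf.mono inter_subset_left)).congr (eqOn_refl _ _) fun y hy ↦ ?_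
    simp [image_eq_zero_of_notMem_tsupport hy.2]

/-- The fields `s` along `f` generate the normal bundle over `S`, and `τ` splits the projection
onto it, so that the normal bundle becomes a direct summand of the trivial bundle `ℝ^α`. -/
structure IsNormalSummand (I : ModelWithCorners ℝ E' H') [IsManifold I ∞ N] (f : E → N) (S : Set E)
    (s : α → E → E') (τ : E → E' →L[ℝ] (α → ℝ)) : Prop where
  smooth : ∀ i, SmoothAlong 𝓘(ℝ, E) I f (s i) S
  smooth_apply : ∀ U, SmoothAlong 𝓘(ℝ, E) I f U S → ContDiffOn ℝ ∞ (fun x ↦ τ x (U x)) S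
  apply_differential : ∀ x ∈ S, ∀ v, τ x (differential 𝓘(ℝ, E) I f S x v) = 0
  sum_apply_smul : ∀ x ∈ S, ∀ w, ∃ v,
    ∑ i, τ x w i • s i x = w + differential 𝓘(ℝ, E) I f S x v

end Summand

section Summand

variable {ι κ α E E' H' N : Type*}
  [NormedAddCommGroup E] [NormedSpace ℝ E]
  [NormedAddCommGroup E'] [NormedSpace ℝ E'] [TopologicalSpace H']
  [TopologicalSpace N] [ChartedSpace H' N]
  {I : ModelWithCorners ℝ E' H'} [IsManifold I ∞ N]
  {f : E → N} {S T : Set E}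

theorem IsNormalSummand.exists_contDiffOn_comp [Fintype α] {s : α → E → E'}
    {τ : E → E' →L[ℝ] (α → ℝ)} (h : IsNormalSummand I f S s τ)
    (hf : ContMDiffOn 𝓘(ℝ, E) I ∞ f S) :
    ∃ Q : E → (α → ℝ) →L[ℝ] (α → ℝ), ContDiffOn ℝ ∞ Q S ∧
      ∀ x w, Q x w = τ x (∑ i, w i • s i x) := by
  let Q (x : E) : (α → ℝ) →L[ℝ] (α → ℝ) :=
    τ x ∘L (Fintype.linearCombination ℝ fun i ↦ s i x).toContinuousLinearMap
  have hQ (x w) : Q x w = τ x (∑ i, w i • s i x) := by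
    simp [Q, Fintype.linearCombination_apply]
  refine ⟨Q, fun x hx ↦ contDiffWithinAt_clm_of_forall_apply fun w ↦ ?_, hQ⟩
  simp only [hQ]
  exact h.smooth_apply _
    (.sum hf _ fun i _ ↦ SmoothAlong.smul contMDiffOn_const (h.smooth i)) x hx

variable [Fintype κ] [FiniteDimensional ℝ E]

theorem IsNormalFrame.exists_sum_inverse_smul {V : κ → E → E'} {x : E}
    (h : IsNormalFrame 𝓘(ℝ, E) I f S T V) (hx : x ∈ T) (w : E') :
    ∃ v, ∑ i, ((frameMap 𝓘(ℝ, E) I f S V x).inverse w).1 i • V i x =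
      w + differential 𝓘(ℝ, E) I f S x v := by
  have hw := (isInvertible_of_bijective (h.bijective x hx)).self_apply_inverse w
  rw [frameMap_apply] at hw
  refine ⟨-((frameMap 𝓘(ℝ, E) I f S V x).inverse w).2, ?_⟩
  rw [map_neg, ← sub_eq_add_neg, eq_sub_iff_add_eq, hw]

theorem IsNormalFrame.inverse_differential {V : κ → E → E'} {x : E}
    (h : IsNormalFrame 𝓘(ℝ, E) I f S T V) (hx : x ∈ T) (v : E) :
    (frameMap 𝓘(ℝ, E) I f S V x).inverse (differential 𝓘(ℝ, E) I f S x v) = (0, v) := by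
  have hv : frameMap 𝓘(ℝ, E) I f S V x (0, v) = differential 𝓘(ℝ, E) I f S x v := by
    simp [frameMap_apply]
  rw [← hv, (isInvertible_of_bijective (h.bijective x hx)).inverse_apply_self]

theorem exists_isNormalSummand [Fintype ι] (hf : ContMDiffOn 𝓘(ℝ, E) I ∞ f S) (hS : IsClosed S)
    (hSd : UniqueDiffOn ℝ S) {u : ι → Set E} (hu : ∀ i, IsOpen (u i)) (hSu : S ⊆ ⋃ i, u i)
    {V : ι → κ → E → E'} (hV : ∀ i, IsNormalFrame 𝓘(ℝ, E) I f S (S ∩ u i) (V i)) :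
    ∃ (s : ι × κ → E → E') (τ : E → E' →L[ℝ] (ι × κ → ℝ)), IsNormalSummand I f S s τ := by
  obtain ⟨ψ, hψ, hψu, hsum⟩ := exists_contDiffOn_sum_sq_eq_one hS hu hSu
  let a (i : ι) (x : E) : E' →L[ℝ] (κ → ℝ) × E := (frameMap 𝓘(ℝ, E) I f S (V i) x).inverse
  let τ (x : E) : E' →L[ℝ] (ι × κ → ℝ) :=
    .pi fun p ↦ ψ p.1 x • (.proj p.2 ∘L .fst ℝ (κ → ℝ) E ∘L a p.1 x)
  have hτ (x w p) : τ x w p = ψ p.1 x * (a p.1 x w).1 p.2 := rfl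
  have hψ0 {i x} (hx : x ∉ u i) : ψ i x = 0 :=
    image_eq_zero_of_notMem_tsupport fun h ↦ hx (hψu i h)
  refine ⟨fun p x ↦ ψ p.1 x • V p.1 p.2 x, τ, fun p ↦ ?_, fun U hU ↦ ?_, fun x hx v ↦ ?_,
    fun x hx w ↦ ?_⟩
  · exact .smul_of_tsupport_subset (hu p.1) hf (hψ p.1) (hψu p.1) ((hV p.1).smooth p.2)
  · refine contDiffOn_pi.2 fun p ↦ ?_
    have ha : ContDiffOn ℝ ∞ (fun x ↦ (a p.1 x (U x)).1 p.2) (S ∩ u p.1) :=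
      (contDiff_apply ℝ ℝ p.2).comp_contDiffOn <| contDiff_fst.comp_contDiffOn <|
        (hV p.1).contDiffOn_inverse hf hSd inter_subset_left (hU.mono inter_subset_left)
    exact (smoothAlong_vectorSpace_iff.1 <| .smul_of_tsupport_subset (hu p.1)
      contMDiffOn_const (hψ p.1) (hψu p.1) <| smoothAlong_vectorSpace_iff.2
        ⟨contMDiffOn_const (c := (0 : ℝ)), ha.contMDiffOn⟩).2.contDiffOn
  · ext p
    by_cases hxu : x ∈ u p.1
    · simp [hτ, a, (hV p.1).inverse_differential ⟨hx, hxu⟩ v]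
    · simp [hτ, hψ0 hxu]
  · have hi (i) : ∃ v, ∑ j, (τ x w (i, j)) • ψ i x • V i j x =
        ψ i x ^ 2 • (w + differential 𝓘(ℝ, E) I f S x v) := by
      by_cases hxu : x ∈ u i
      · obtain ⟨v, hv⟩ := (hV i).exists_sum_inverse_smul ⟨hx, hxu⟩ w
        refine ⟨v, ?_⟩
        rw [← hv, Finset.smul_sum]
        refine Finset.sum_congr rfl fun j _ ↦ ?_
        rw [hτ, smul_smul, smul_smul]
        exact congrArg (· • V i j x) (by ring)
      · exact ⟨0, by simp [hψ0 hxu]⟩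
    choose v hv using hi
    refine ⟨∑ i, ψ i x ^ 2 • v i, ?_⟩
    simp only [Fintype.sum_prod_type, hv, smul_add, Finset.sum_add_distrib, ← Finset.sum_smul,
      hsum x hx, one_smul, map_sum, map_smul]

theorem IsNormalSummand.exists_isNormalFrame [Fintype α] [FiniteDimensional ℝ E'] {a : E}
    {s : α → E → E'} {τ : E → E' →L[ℝ] (α → ℝ)} (h : IsNormalSummand I f S s τ)
    (hdim : Fintype.card κ + Module.finrank ℝ E = Module.finrank ℝ E')
    (hS : IsCompact S) (hSa : StarConvex ℝ a S) (ha : a ∈ S)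
    (hf : ContMDiffOn 𝓘(ℝ, E) I ∞ f S)
    (hinj : ∀ x ∈ S, Function.Injective (differential 𝓘(ℝ, E) I f S x)) :
    ∃ V : κ → E → E', IsNormalFrame 𝓘(ℝ, E) I f S S V := by
  obtain ⟨Q, hQs, hQ⟩ := h.exists_contDiffOn_comp hf
  have hQτ (x) (hx : x ∈ S) (w) : Q x (τ x w) = τ x w := by
    obtain ⟨v, hv⟩ := h.sum_apply_smul x hx w
    rw [hQ, hv, map_add, h.apply_differential x hx, add_zero]
  obtain ⟨F, hF, hFinj⟩ := exists_contDiffOn_injOn_of_isIdempotentElem hS hSa hQs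
    fun x hx w ↦ by rw [hQ x w, hQτ x hx]
  obtain ⟨w, hw⟩ := exists_linearIndependent_mod_range (κ := κ) hdim (hinj a ha)
  refine ⟨fun i x ↦ ∑ j, F x (τ a (w i)) j • s j x, fun i ↦ .sum hf _ fun j _ ↦
    SmoothAlong.smul (contDiffOn_pi.1 (hF.clm_apply contDiffOn_const) j).contMDiffOn (h.smooth j),
    fun x hx ↦ bijective_frameMap_of_injective hdim <|
      injective_frameMap_iff.2 ⟨hinj x hx, fun c v hcv ↦ ?_⟩⟩
  have hQF : Q x (F x (τ a (∑ i, c i • w i))) = 0 := by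
    have hlin : Q x (F x (τ a (∑ i, c i • w i))) = ∑ i, c i • Q x (F x (τ a (w i))) := by
      simp only [map_sum, map_smul]
    simp only [hlin, hQ, ← map_smul (τ x), ← map_sum (τ x), hcv]
    exact h.apply_differential x hx v
  obtain ⟨v', hv'⟩ := h.sum_apply_smul a ha (∑ i, c i • w i)
  refine hw c (-v') ?_
  rw [hFinj x hx _ (hQτ a ha _) hQF] at hv'
  simp only [Pi.zero_apply, zero_smul, Finset.sum_const_zero] at hv'
  rw [map_neg, eq_neg_iff_add_eq_zero, ← hv']

theorem exists_isNormalFrame_of_starConvex [FiniteDimensional ℝ E'] {a : E}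
    (hdim : Fintype.card κ + Module.finrank ℝ E = Module.finrank ℝ E')
    (hS : IsCompact S) (hSa : StarConvex ℝ a S) (ha : a ∈ S) (hSd : UniqueDiffOn ℝ S)
    (hf : ContMDiffOn 𝓘(ℝ, E) I ∞ f S)
    (hinj : ∀ x ∈ S, Function.Injective (differential 𝓘(ℝ, E) I f S x)) :
    ∃ V : κ → E → E', IsNormalFrame 𝓘(ℝ, E) I f S S V := by
  choose u V hu hxu hV using fun x : S ↦
    exists_isNormalFrame_nhds hdim hf hSd x.2 (hinj x x.2)
  obtain ⟨t, ht⟩ := hS.elim_finite_subcover u hu fun x hx ↦ mem_iUnion.2 ⟨⟨x, hx⟩, hxu ⟨x, hx⟩⟩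
  obtain ⟨s, τ, h⟩ := exists_isNormalSummand (ι := t) hf hS.isClosed hSd (fun i ↦ hu i)
    (by simpa only [iUnion_coe_set, iUnion_subtype] using ht) fun i ↦ hV i
  exact h.exists_isNormalFrame hdim hS hSa ha hf hinj

end Summand

/-! ### Embeddings and their normal frames -/

section EmbeddedOn

variable {E H M E' H' N : Type*}
  [NormedAddCommGroup E] [NormedSpace ℝ E] [TopologicalSpace H]
  [TopologicalSpace M] [ChartedSpace H M]
  [NormedAddCommGroup E'] [NormedSpace ℝ E'] [TopologicalSpace H']
  [TopologicalSpace N] [ChartedSpace H' N]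
  {J : ModelWithCorners ℝ E H} {I : ModelWithCorners ℝ E' H'} {f : M → N} {S : Set M}

/-- `f` restricts to a smooth embedding of `S ⊆ M`; one-sided derivatives are taken at the boundary
of `S`. -/
structure IsEmbeddedOn (J : ModelWithCorners ℝ E H) (I : ModelWithCorners ℝ E' H') (f : M → N)
    (S : Set M) : Prop where
  uniqueMDiffOn : UniqueMDiffOn J S
  smooth : ContMDiffOn J I ∞ f S
  isEmbedding : IsEmbedding (S.domRestrict f)
  immersive : ∀ x ∈ S, Function.Injective (differential J I f S x)

theorem IsEmbeddedOn.injOn (hf : IsEmbeddedOn J I f S) : InjOn f S :=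
  injOn_iff_injective.2 hf.isEmbedding.injective

theorem IsEmbeddedOn.continuousOn_lift {X : Type*} [TopologicalSpace X] {g : X → M} {T : Set X}
    (hf : IsEmbeddedOn J I f S) (hg : MapsTo g T S) (hfg : ContinuousOn (f ∘ g) T) :
    ContinuousOn g T := by
  rw [continuousOn_iff_continuous_domRestrict] at hfg ⊢
  exact continuous_subtype_val.comp
    (hf.isEmbedding.continuous_iff.2 hfg : Continuous fun x : T ↦ (⟨g x, hg x.2⟩ : S))

theorem isEmbedding_domRestrict_of_isCompact {X Y : Type*} [TopologicalSpace X]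
    [TopologicalSpace Y] [T2Space Y] {f : X → Y} {K S : Set X} (hK : IsCompact K)
    (hf : ContinuousOn f K) (hinj : InjOn f K) (hSK : S ⊆ K) : IsEmbedding (S.domRestrict f) := by
  have : CompactSpace K := isCompact_iff_compactSpace.1 hK
  have hemb : IsEmbedding (K.domRestrict f) :=
    (Continuous.isClosedEmbedding hf.domRestrict hinj.injective).isEmbedding
  exact hemb.comp (.inclusion hSK)

theorem IsEmbeddedOn.inter {u : Set M} (hf : IsEmbeddedOn J I f S) (hu : IsOpen u) :
    IsEmbeddedOn J I f (S ∩ u) where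
  uniqueMDiffOn := hf.uniqueMDiffOn.inter hu
  smooth := hf.smooth.mono inter_subset_left
  isEmbedding := hf.isEmbedding.comp (.inclusion inter_subset_left)
  immersive x hx := by
    rw [differential_inter hu hx.2]
    exact hf.immersive x hx.1

end EmbeddedOn

section Lift

variable {κ E M E' H' N G : Type*} [Fintype κ]
  [NormedAddCommGroup E] [NormedSpace ℝ E] [TopologicalSpace M] [ChartedSpace E M]
  [NormedAddCommGroup E'] [NormedSpace ℝ E'] [TopologicalSpace H']
  [TopologicalSpace N] [ChartedSpace H' N] [NormedAddCommGroup G] [NormedSpace ℝ G]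
  {I : ModelWithCorners ℝ E' H'} {f : M → N} {S : Set M} {f' : G → N} {T : Set G}
  [FiniteDimensional ℝ E] [FiniteDimensional ℝ E'] [IsManifold 𝓘(ℝ, E) ∞ M] [IsManifold I ∞ N]
  [Nonempty M]

theorem IsEmbeddedOn.exists_lift (hf : IsEmbeddedOn 𝓘(ℝ, E) I f S) (hT : UniqueMDiffOn 𝓘(ℝ, G) T)
    (hf' : ContMDiffOn 𝓘(ℝ, G) I ∞ f' T) (hmaps : MapsTo f' T (f '' S)) :
    ∃ g : G → M, ContMDiffOn 𝓘(ℝ, G) 𝓘(ℝ, E) ∞ g T ∧ MapsTo g T S ∧ EqOn f' (f ∘ g) T ∧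
      ∀ x ∈ T, differential 𝓘(ℝ, G) I f' T x =
        differential 𝓘(ℝ, E) I f S (g x) ∘L differential 𝓘(ℝ, G) 𝓘(ℝ, E) g T x := by
  let g (x : G) : M := Function.invFunOn f S (f' x)
  have hgS : MapsTo g T S := fun x hx ↦ Function.invFunOn_mem (hmaps hx)
  have heq : EqOn f' (f ∘ g) T := fun x hx ↦ (Function.invFunOn_eq (hmaps hx)).symm
  have hg := contMDiffOn_of_comp_immersion hf.uniqueMDiffOn hT.uniqueDiffOn hf.smooth hf.immersive
    (hf.continuousOn_lift hgS (hf'.continuousOn.congr heq.symm)) hgS hf' fun x hx ↦ (heq hx).symm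
  exact ⟨g, hg, hgS, heq, fun x hx ↦
    differential_eq_comp hf.smooth hg hT hgS heq hx⟩

theorem IsNormalFrame.of_mapsTo_image [FiniteDimensional ℝ G] {X : κ → N → E'}
    (hX : IsNormalFrame 𝓘(ℝ, E) I f S S fun i x ↦ X i (f x)) (hf : IsEmbeddedOn 𝓘(ℝ, E) I f S)
    (hf' : IsEmbeddedOn 𝓘(ℝ, G) I f' T) (hdim : Module.finrank ℝ G = Module.finrank ℝ E)
    (hmaps : MapsTo f' T (f '' S)) :
    IsNormalFrame 𝓘(ℝ, G) I f' T T fun i x ↦ X i (f' x) := by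
  obtain ⟨g, hg, hgS, heq, hd⟩ := hf.exists_lift hf'.uniqueMDiffOn hf'.smooth hmaps
  refine (hX.comp hg hgS heq (differential 𝓘(ℝ, G) 𝓘(ℝ, E) g T) (fun x hx ↦ ?_) hd).congr
    fun x hx i ↦ congrArg (X i) (heq hx)
  have hgx : Function.Injective (differential 𝓘(ℝ, G) 𝓘(ℝ, E) g T x) :=
    .of_comp (f := differential 𝓘(ℝ, E) I f S (g x)) (by
      rw [← ContinuousLinearMap.coe_comp, ← hd x hx]
      exact hf'.immersive x hx)
  exact ⟨hgx, (LinearMap.injective_iff_surjective_of_finrank_eq_finrank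
    (f := (differential 𝓘(ℝ, G) 𝓘(ℝ, E) g T x).toLinearMap) hdim).1 hgx⟩

theorem IsEmbeddedOn.range_differential_eq (hf : IsEmbeddedOn 𝓘(ℝ, E) I f S)
    (hf' : IsEmbeddedOn 𝓘(ℝ, G) I f' T) (hdim : Module.finrank ℝ G = Module.finrank ℝ E)
    (hmaps : MapsTo f' T (f '' S)) {x : G} {y : M} (hx : x ∈ T) (hy : y ∈ S) (hxy : f' x = f y) :
    (differential 𝓘(ℝ, G) I f' T x).range = (differential 𝓘(ℝ, E) I f S y).range := by
  obtain ⟨g, -, hgS, heq, hd⟩ := hf.exists_lift hf'.uniqueMDiffOn hf'.smooth hmaps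
  obtain rfl : g x = y := hf.injOn (hgS hx) hy ((heq hx).symm.trans hxy)
  refine Submodule.eq_of_le_of_finrank_eq ?_ ?_
  · rw [hd x hx]
    exact LinearMap.range_comp_le_range _ _
  · rw [LinearMap.finrank_range_of_inj (hf'.immersive x hx),
      LinearMap.finrank_range_of_inj (hf.immersive _ hy), hdim]

end Lift

section Glue

variable {κ E H M E' H' N : Type*} [Fintype κ]
  [NormedAddCommGroup E] [NormedSpace ℝ E] [TopologicalSpace H]
  [TopologicalSpace M] [ChartedSpace H M]
  [NormedAddCommGroup E'] [NormedSpace ℝ E'] [TopologicalSpace H']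
  [TopologicalSpace N] [ChartedSpace H' N]
  {J : ModelWithCorners ℝ E H} {I : ModelWithCorners ℝ E' H'} [IsManifold I ∞ N]
  {f : M → N} {S u : Set M} {V : κ → M → E'}

theorem isNormalFrame_inter_iff (hu : IsOpen u) :
    IsNormalFrame J I f (S ∩ u) (S ∩ u) V ↔ IsNormalFrame J I f S (S ∩ u) V := by
  have h (x) (hx : x ∈ S ∩ u) : frameMap J I f (S ∩ u) V x = frameMap J I f S V x := by
    rw [frameMap, differential_inter hu hx.2, frameMap]
  exact ⟨fun hV ↦ ⟨hV.smooth, fun x hx ↦ h x hx ▸ hV.bijective x hx⟩,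
    fun hV ↦ ⟨hV.smooth, fun x hx ↦ (h x hx).symm ▸ hV.bijective x hx⟩⟩

end Glue

section Transverse

variable {κ E H M E' H' N Q : Type*} [Fintype κ]
  [NormedAddCommGroup E] [NormedSpace ℝ E] [TopologicalSpace H]
  [TopologicalSpace M] [ChartedSpace H M]
  [NormedAddCommGroup E'] [NormedSpace ℝ E'] [TopologicalSpace H']
  [TopologicalSpace N] [ChartedSpace H' N] [AddCommGroup Q] [Module ℝ Q]
  {J : ModelWithCorners ℝ E H} {I : ModelWithCorners ℝ E' H'}
  {f : M → N} {S T : Set M} {V : κ → M → E'} {x : M}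

theorem injective_frameMap_of_linearIndependent (hf : Function.Injective (differential J I f S x))
    (L : E' →ₗ[ℝ] Q) (hL : ∀ v, L (differential J I f S x v) = 0)
    (hV : LinearIndependent ℝ fun i ↦ L (V i x)) :
    Function.Injective (frameMap J I f S V x) := by
  refine injective_frameMap_iff.2 ⟨hf, fun c v hc ↦
    funext <| Fintype.linearIndependent_iff.1 hV c ?_⟩
  rw [← hL v, ← hc, map_sum]
  simp only [map_smul]

theorem IsNormalFrame.linearIndependent_map [IsManifold I ∞ N] (hV : IsNormalFrame J I f S T V)
    (hx : x ∈ T) (L : E' →ₗ[ℝ] Q) (hL : ∀ w, L w = 0 → ∃ v, differential J I f S x v = w) :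
    LinearIndependent ℝ fun i ↦ L (V i x) := by
  refine Fintype.linearIndependent_iff.2 fun c hc ↦ congrFun ?_
  simp only [← map_smul, ← map_sum] at hc
  obtain ⟨v, hv⟩ := hL _ hc
  exact hV.eq_zero hx hv.symm

end Transverse

section Constructions

variable {E H M E' H' N F H'' P : Type*}
  [NormedAddCommGroup E] [NormedSpace ℝ E] [TopologicalSpace H]
  [TopologicalSpace M] [ChartedSpace H M]
  [NormedAddCommGroup E'] [NormedSpace ℝ E'] [TopologicalSpace H']
  [TopologicalSpace N] [ChartedSpace H' N]
  [NormedAddCommGroup F] [NormedSpace ℝ F] [TopologicalSpace H'']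
  [TopologicalSpace P] [ChartedSpace H'' P]
  {J : ModelWithCorners ℝ E H} {I : ModelWithCorners ℝ E' H'} {I' : ModelWithCorners ℝ F H''}
  {f : M → N} {S : Set M}

theorem IsEmbeddedDisk.isEmbeddedOn {I : ModelWithCorners ℝ (Euc 5) H} [T2Space M]
    {f : Euc 2 → M} (hf : IsEmbeddedDisk I f) : IsEmbeddedOn 𝓘(ℝ, Euc 2) I f disk where
  uniqueMDiffOn := (uniqueDiffOn_convex (convex_closedBall 0 1)
    (by simp [interior_closedBall])).uniqueMDiffOn
  smooth := hf.smooth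
  isEmbedding := isEmbedding_domRestrict_of_isCompact (isCompact_closedBall 0 1)
    hf.smooth.continuousOn hf.injOn Subset.rfl
  immersive := hf.immersive

theorem isEmbeddedOn_univ_of_isSmoothEmbedding {M : Type*} [TopologicalSpace M] [ChartedSpace E M]
    [IsManifold 𝓘(ℝ, E) ∞ M] {f : M → N}
    (hf : Manifold.IsSmoothEmbedding 𝓘(ℝ, E) I ∞ f) : IsEmbeddedOn 𝓘(ℝ, E) I f univ where
  uniqueMDiffOn := uniqueMDiffOn_univ
  smooth := hf.isImmersion.contMDiff.contMDiffOn
  isEmbedding := hf.isEmbedding.comp .subtypeVal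
  immersive x _ := by
    rw [differential, mfderivWithin_univ]
    exact injective_mfderiv_of_isImmersionAt (hf.isImmersion.isImmersionAt x)

theorem exists_extend_of_injOn {κ M N X : Type*} [Nonempty M] {f : M → N} {S : Set M}
    (hf : InjOn f S) (V : κ → M → X) : ∃ U : κ → N → X, ∀ x ∈ S, ∀ i, U i (f x) = V i x :=
  ⟨fun i p ↦ V i (Function.invFunOn f S p), fun _ hx i ↦ congrArg (V i) (hf.leftInvOn_invFunOn hx)⟩

theorem IsFraming.exists_isNormalFrame [FiniteDimensional ℝ E] [FiniteDimensional ℝ E']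
    [IsManifold I ∞ N] {k : ℕ} (hk : k + Module.finrank ℝ E = Module.finrank ℝ E')
    (hf : ∀ x ∈ S, Function.Injective (differential J I f S x))
    {B : ∀ x, Submodule ℝ (NormalSpace J I f S x)} {φ : Fin k → ∀ x, NormalSpace J I f S x}
    (hφ : IsFraming J I f S B φ) : ∃ V : Fin k → M → E', IsNormalFrame J I f S S V := by
  choose V hV hφV using hφ.smooth
  refine ⟨V, hV, fun x hx ↦ bijective_frameMap_of_injective (by simpa using hk) <|
    injective_frameMap_of_linearIndependent (hf x hx) (tangentImage J I f S x).mkQ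
      (fun v ↦ (Submodule.Quotient.mk_eq_zero _).2 ⟨v, rfl⟩) ?_⟩
  have hli := hφ.linearIndependent x hx
  simp only [hφV _ x hx] at hli
  exact hli

end Constructions

section Diffeo

variable {E H M E' H' N F : Type*}
  [NormedAddCommGroup E] [NormedSpace ℝ E] [TopologicalSpace H]
  [TopologicalSpace M] [ChartedSpace H M]
  [NormedAddCommGroup E'] [NormedSpace ℝ E'] [TopologicalSpace H']
  [TopologicalSpace N] [ChartedSpace H' N]
  [NormedAddCommGroup F] [NormedSpace ℝ F]
  {J : ModelWithCorners ℝ E H} {I : ModelWithCorners ℝ E' H'}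
  {Ψ : OpenPartialHomeomorph M N}

theorem differential_symm_comp_differential (hΨ : ContMDiffOn J I ∞ Ψ Ψ.source)
    (hΨ' : ContMDiffOn I J ∞ Ψ.symm Ψ.target) {x : M} (hx : x ∈ Ψ.source) :
    differential I J Ψ.symm Ψ.target (Ψ x) ∘L differential J I Ψ Ψ.source x = .id ℝ E := by
  have hS := Ψ.open_source.uniqueMDiffOn (I := J)
  rw [← differential_eq_comp hΨ' hΨ hS Ψ.mapsTo (h := id) (fun y hy ↦ (Ψ.left_inv hy).symm) hx]
  exact mfderivWithin_id (hS x hx)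

theorem differential_comp_differential_symm (hΨ : ContMDiffOn J I ∞ Ψ Ψ.source)
    (hΨ' : ContMDiffOn I J ∞ Ψ.symm Ψ.target) {x : M} (hx : x ∈ Ψ.source) :
    differential J I Ψ Ψ.source x ∘L differential I J Ψ.symm Ψ.target (Ψ x) = .id ℝ E' := by
  have h := differential_symm_comp_differential (Ψ := Ψ.symm) hΨ' hΨ (Ψ.mapsTo hx)
  rwa [Ψ.symm_symm, Ψ.left_inv hx] at h

theorem bijective_differential (hΨ : ContMDiffOn J I ∞ Ψ Ψ.source)
    (hΨ' : ContMDiffOn I J ∞ Ψ.symm Ψ.target) {x : M} (hx : x ∈ Ψ.source) :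
    Function.Bijective (differential J I Ψ Ψ.source x) :=
  Function.bijective_iff_has_inverse.2 ⟨differential I J Ψ.symm Ψ.target (Ψ x),
    DFunLike.congr_fun (differential_symm_comp_differential hΨ hΨ' hx),
    DFunLike.congr_fun (differential_comp_differential_symm hΨ hΨ' hx)⟩

variable {G M' : Type*} [TopologicalSpace G] [TopologicalSpace M'] [ChartedSpace G M']
  {J' : ModelWithCorners ℝ F G} {p : M' → M} {A : Set M'}

theorem IsEmbeddedOn.diffeo_comp (hp : IsEmbeddedOn J' J p A)
    (hΨ : ContMDiffOn J I ∞ Ψ Ψ.source) (hΨ' : ContMDiffOn I J ∞ Ψ.symm Ψ.target)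
    (hpA : MapsTo p A Ψ.source) : IsEmbeddedOn J' I (Ψ ∘ p) A where
  uniqueMDiffOn := hp.uniqueMDiffOn
  smooth := hΨ.comp hp.smooth hpA
  isEmbedding := by
    have h : IsEmbedding (Ψ.source.domRestrict Ψ) := Ψ.isOpenEmbedding_restrict.isEmbedding
    have hA : IsEmbedding fun x : A ↦ (⟨p x, hpA x.2⟩ : Ψ.source) :=
      .of_comp (continuous_induced_rng.2 hp.isEmbedding.continuous) continuous_subtype_val
        hp.isEmbedding
    exact h.comp hA
  immersive x hx := by
    rw [differential_eq_comp hΨ hp.smooth hp.uniqueMDiffOn hpA (eqOn_refl _ _) hx]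
    exact (bijective_differential hΨ hΨ' (hpA hx)).1.comp (hp.immersive x hx)

theorem IsNormalFrame.diffeo_comp {κ : Type*} [Fintype κ] [IsManifold J ∞ M] [IsManifold I ∞ N]
    {V : κ → M' → E} {q : M' → N} (hV : IsNormalFrame J' J p A A V)
    (hp : ContMDiffOn J' J ∞ p A) (hA : UniqueMDiffOn J' A)
    (hΨ : ContMDiffOn J I ∞ Ψ Ψ.source) (hΨ' : ContMDiffOn I J ∞ Ψ.symm Ψ.target)
    (hpA : MapsTo p A Ψ.source) (hq : EqOn q (Ψ ∘ p) A) :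
    IsNormalFrame J' I q A A fun i x ↦ differential J I Ψ Ψ.source (p x) (V i x) :=
  hV.postcomp hΨ Ψ.open_source.uniqueMDiffOn hpA (fun _ ↦ bijective_differential hΨ hΨ') hq
    fun _ ↦ differential_eq_comp hΨ hp hA hpA hq

end Diffeo

section ImageSubset

variable {κ E M E' H' N G : Type*} [Fintype κ]
  [NormedAddCommGroup E] [NormedSpace ℝ E] [TopologicalSpace M] [ChartedSpace E M]
  [NormedAddCommGroup E'] [NormedSpace ℝ E'] [TopologicalSpace H']
  [TopologicalSpace N] [ChartedSpace H' N] [NormedAddCommGroup G] [NormedSpace ℝ G]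
  {I : ModelWithCorners ℝ E' H'} {f : M → N} {S : Set M} {f' : G → N} {T : Set G} {O : Set N}
  [FiniteDimensional ℝ E] [FiniteDimensional ℝ E'] [IsManifold 𝓘(ℝ, E) ∞ M] [IsManifold I ∞ N]
  [Nonempty M]

theorem IsEmbeddedOn.range_differential_eq_of_inter_subset (hf : IsEmbeddedOn 𝓘(ℝ, E) I f S)
    (hf' : IsEmbeddedOn 𝓘(ℝ, G) I f' T) (hdim : Module.finrank ℝ G = Module.finrank ℝ E)
    (hO : IsOpen O) (hsub : f' '' T ∩ O ⊆ f '' S) {x : G} {y : M} (hx : x ∈ T) (hy : y ∈ S)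
    (hxy : f' x = f y) (hxO : f' x ∈ O) :
    (differential 𝓘(ℝ, G) I f' T x).range = (differential 𝓘(ℝ, E) I f S y).range := by
  obtain ⟨u, hu, hTu⟩ := continuousOn_iff'.1 hf'.smooth.continuousOn O hO
  rw [inter_comm, inter_comm u] at hTu
  have hxu : x ∈ T ∩ u := hTu ▸ ⟨hx, hxO⟩
  rw [← differential_inter hu hxu.2]
  exact hf.range_differential_eq (hf'.inter hu) hdim
    (hTu ▸ fun y hy ↦ hsub ⟨mem_image_of_mem f' hy.1, hy.2⟩) hxu hy hxy

theorem IsNormalFrame.of_image_inter_subset [FiniteDimensional ℝ G] {X : κ → N → E'}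
    (hX : IsNormalFrame 𝓘(ℝ, E) I f S S fun i x ↦ X i (f x)) (hf : IsEmbeddedOn 𝓘(ℝ, E) I f S)
    (hf' : IsEmbeddedOn 𝓘(ℝ, G) I f' T) (hdim : Module.finrank ℝ G = Module.finrank ℝ E)
    (hO : IsOpen O) (hsub : f' '' T ∩ O ⊆ f '' S) :
    IsNormalFrame 𝓘(ℝ, G) I f' T (T ∩ f' ⁻¹' O) fun i x ↦ X i (f' x) := by
  obtain ⟨u, hu, hTu⟩ := continuousOn_iff'.1 hf'.smooth.continuousOn O hO
  rw [inter_comm, inter_comm u] at hTu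
  rw [hTu, ← isNormalFrame_inter_iff hu]
  exact hX.of_mapsTo_image hf (hf'.inter hu) hdim
    (hTu ▸ fun y hy ↦ hsub ⟨mem_image_of_mem f' hy.1, hy.2⟩)

end ImageSubset

/-! ### The tube in the local model -/

section LinearAlgebra

theorem exists_equiv_sum_smul_eq {κ E : Type*} [Fintype κ] [DecidableEq κ] [AddCommGroup E]
    [Module ℝ E] (hκ : Fintype.card κ = Module.finrank ℝ E) {v w : κ → E}
    (hv : LinearIndependent ℝ v) (hw : LinearIndependent ℝ w) :
    ∃ C : (κ → ℝ) ≃ₗ[ℝ] (κ → ℝ), ∀ i, ∑ j, C (Pi.single i 1) j • v j = w i := by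
  cases isEmpty_or_nonempty κ
  · exact ⟨.refl ℝ _, isEmptyElim⟩
  let bv := basisOfLinearIndependentOfCardEqFinrank hv hκ
  let bw := basisOfLinearIndependentOfCardEqFinrank hw hκ
  refine ⟨bw.equivFun.symm.trans bv.equivFun, fun i ↦ ?_⟩
  have h := bv.equivFun.symm_apply_apply (bw i)
  rw [bv.equivFun_symm_apply] at h
  simpa [bv, bw] using h

end LinearAlgebra

section Sheet

variable {F G : Type*} [NormedAddCommGroup F] [NormedSpace ℝ F] [NormedAddCommGroup G]
  [NormedSpace ℝ G]

/-- The inclusion of the plane `z = h`, `w = 0` into the local model. -/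
def sheet (h : ℝ) (y : F) : F × ℝ × G := (y, h, 0)

theorem contDiff_sheet (h : ℝ) : ContDiff ℝ ∞ (sheet h : F → F × ℝ × G) :=
  contDiff_id.prodMk contDiff_const

theorem differential_sheet {h : ℝ} {U : Set F} (hU : IsOpen U) {y : F} (hy : y ∈ U) :
    differential 𝓘(ℝ, F) 𝓘(ℝ, F × ℝ × G) (sheet h : F → F × ℝ × G) U y = .inl ℝ F (ℝ × G) := by
  rw [differential_eq_fderivWithin, fderivWithin_of_isOpen hU hy]
  exact ((hasFDerivAt_id y).prodMk (hasFDerivAt_const (h, (0 : G)) y)).fderiv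

theorem isEmbeddedOn_sheet (h : ℝ) {U : Set F} (hU : IsOpen U) :
    IsEmbeddedOn 𝓘(ℝ, F) 𝓘(ℝ, F × ℝ × G) (sheet h : F → F × ℝ × G) U where
  uniqueMDiffOn := hU.uniqueMDiffOn
  smooth := (contDiff_sheet h).contMDiff.contMDiffOn
  isEmbedding := (IsEmbedding.of_leftInverse (f := Prod.fst) (fun _ ↦ rfl) continuous_fst
    (contDiff_sheet h).continuous).comp .subtypeVal
  immersive y hy := by
    rw [differential_sheet hU hy]
    exact Prod.mk_left_injective 0

theorem IsNormalFrame.linearIndependent_snd {κ : Type*} [Fintype κ] {h : ℝ} {U : Set F}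
    {V : κ → F → F × ℝ × G}
    (hV : IsNormalFrame 𝓘(ℝ, F) 𝓘(ℝ, F × ℝ × G) (sheet h : F → F × ℝ × G) U U V)
    (hU : IsOpen U) {y : F} (hy : y ∈ U) : LinearIndependent ℝ fun i ↦ (V i y).2 :=
  hV.linearIndependent_map hy (LinearMap.snd ℝ F (ℝ × G)) fun w hw ↦
    ⟨w.1, by rw [differential_sheet hU hy]; exact Prod.ext rfl hw.symm⟩

end Sheet

section Profile

variable {r z : ℝ → ℝ}

theorem IsTubeProfile.r_pos (h : IsTubeProfile r z) (t : ℝ) : 0 < r t := by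
  rcases le_or_gt t (-1) with h₁ | h₁
  · rw [(h.incoming t h₁).1]; linarith
  · rcases lt_or_ge t 1 with h₂ | h₂
    · exact (h.middle t h₁ h₂).1
    · rw [(h.outgoing t h₂).1]; linarith

theorem IsTubeProfile.r_le_one (h : IsTubeProfile r z) {t : ℝ} (h₁ : -1 ≤ t) (h₂ : t ≤ 1) :
    r t ≤ 1 := by
  rcases h₁.eq_or_lt with rfl | h₁
  · rw [(h.incoming _ le_rfl).1, neg_neg]
  rcases h₂.eq_or_lt with rfl | h₂
  · rw [(h.outgoing _ le_rfl).1]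
  exact (h.middle t h₁ h₂).2.1.le

theorem IsTubeProfile.deriv_of_lt (h : IsTubeProfile r z) {t : ℝ} (ht : t < -1) :
    deriv r t = -1 ∧ deriv z t = 0 := by
  have hr : r =ᶠ[𝓝 t] fun s ↦ -s := by
    filter_upwards [Iio_mem_nhds ht] with s hs using (h.incoming s (le_of_lt hs)).1
  have hz : z =ᶠ[𝓝 t] fun _ ↦ 0 := by
    filter_upwards [Iio_mem_nhds ht] with s hs using (h.incoming s (le_of_lt hs)).2
  rw [hr.deriv_eq, hz.deriv_eq, deriv_neg'', deriv_const]
  exact ⟨rfl, rfl⟩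

theorem IsTubeProfile.deriv_of_gt (h : IsTubeProfile r z) {t : ℝ} (ht : 1 < t) :
    deriv r t = 1 ∧ deriv z t = 0 := by
  have hr : r =ᶠ[𝓝 t] fun s ↦ s := by
    filter_upwards [Ioi_mem_nhds ht] with s hs using (h.outgoing s (le_of_lt hs)).1
  have hz : z =ᶠ[𝓝 t] fun _ ↦ 1 := by
    filter_upwards [Ioi_mem_nhds ht] with s hs using (h.outgoing s (le_of_lt hs)).2
  rw [hr.deriv_eq, hz.deriv_eq, deriv_id'', deriv_const]
  exact ⟨rfl, rfl⟩

theorem IsTubeProfile.hasDerivAt_r (h : IsTubeProfile r z) (t : ℝ) :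
    HasDerivAt r (deriv r t) t :=
  (h.smooth_r.differentiable (by simp) t).hasDerivAt

theorem IsTubeProfile.hasDerivAt_z (h : IsTubeProfile r z) (t : ℝ) :
    HasDerivAt z (deriv z t) t :=
  (h.smooth_z.differentiable (by simp) t).hasDerivAt

end Profile

section Polar

variable {F : Type*} [NormedAddCommGroup F] [InnerProductSpace ℝ F] {x : F}

/-- The unit vector in the direction of `x`, with value `0` at `x = 0`. -/
noncomputable def direction (x : F) : F := ‖x‖⁻¹ • x

theorem norm_direction (hx : x ≠ 0) : ‖direction x‖ = 1 := by
  rw [direction, norm_smul, norm_inv, norm_norm, inv_mul_cancel₀ (norm_ne_zero_iff.2 hx)]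

theorem norm_smul_direction (x : F) : ‖x‖ • direction x = x := by
  obtain rfl | hx := eq_or_ne x 0
  · rw [norm_zero, zero_smul]
  · rw [direction, smul_smul, mul_inv_cancel₀ (norm_ne_zero_iff.2 hx), one_smul]

theorem direction_smul {c : ℝ} (hc : 0 < c) (hx : ‖x‖ = 1) : direction (c • x) = x := by
  rw [direction, norm_smul, hx, mul_one, Real.norm_of_nonneg hc.le, smul_smul,
    inv_mul_cancel₀ hc.ne', one_smul]

theorem contDiffOn_direction : ContDiffOn ℝ ∞ (direction : F → F) {0}ᶜ :=
  ((contDiffOn_id.norm ℝ fun x (hx : x ≠ 0) ↦ hx).inv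
    fun x (hx : x ≠ 0) ↦ norm_ne_zero_iff.2 hx).smul contDiffOn_id

theorem hasFDerivAt_norm (hx : x ≠ 0) : HasFDerivAt (‖·‖) (innerSL ℝ (direction x)) x := by
  have h := (hasStrictFDerivAt_norm_sq x).hasFDerivAt.sqrt (by simpa using hx)
  simp only [Real.sqrt_sq (norm_nonneg _)] at h
  refine h.congr_fderiv ?_
  ext v
  simp [direction]
  ring

end Polar

section PolarDerivative

variable {F : Type*} [NormedAddCommGroup F] [InnerProductSpace ℝ F] {x : F}

theorem inner_direction_self (hx : x ≠ 0) : inner ℝ (direction x) (direction x) = (1 : ℝ) := by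
  rw [real_inner_self_eq_norm_sq, norm_direction hx, one_pow]

theorem hasFDerivAt_direction (hx : x ≠ 0) : HasFDerivAt direction
    (‖x‖⁻¹ • (.id ℝ F - (innerSL ℝ (direction x)).smulRight (direction x))) x := by
  have hinv := (hasDerivAt_inv (norm_ne_zero_iff.2 hx)).comp_hasFDerivAt x (hasFDerivAt_norm hx)
  refine (hinv.smul (hasFDerivAt_id x)).congr_fderiv ?_
  ext v
  simp only [Function.comp_apply, direction, map_smul, smul_smul, neg_mul, neg_smul, id_eq,
    add_apply, smul_apply, ContinuousLinearMap.id_apply, ContinuousLinearMap.smulRight_apply,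
    neg_apply, coe_innerSL_apply, smul_eq_mul, smul_sub, sub_apply]
  module

end PolarDerivative

section TubeDomain

variable {F : Type*} [NormedAddCommGroup F] {y : F}

/-- The annulus that parametrizes the tube together with collars of both ends. -/
def tubeDomain : Set F := {y | ‖y‖ ∈ Ioo 1 5}

/-- The profile parameter of the point `y` of the annulus `tubeDomain`. -/
def tubeParam (y : F) : ℝ := ‖y‖ - 3

theorem isOpen_tubeDomain : IsOpen (tubeDomain : Set F) := isOpen_Ioo.preimage continuous_norm

theorem ne_zero_of_mem_tubeDomain (hy : y ∈ tubeDomain) : y ≠ 0 :=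
  norm_pos_iff.1 (zero_lt_one.trans hy.1)

theorem abs_tubeParam_lt (hy : y ∈ tubeDomain) : |tubeParam y| < 2 :=
  abs_lt.2 ⟨by unfold tubeParam; linarith [hy.1], by unfold tubeParam; linarith [hy.2]⟩

end TubeDomain

section TubeMap

variable {F G : Type*} [NormedAddCommGroup F] [InnerProductSpace ℝ F] [NormedAddCommGroup G]
  {r z : ℝ → ℝ} {y : F}

/-- The parametrization of the tube with profile `(r, z)` by polar coordinates. -/
noncomputable def tubeMap (r z : ℝ → ℝ) (y : F) : F × ℝ × G :=
  (r (tubeParam y) • direction y, z (tubeParam y), 0)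

theorem contDiffOn_tubeParam : ContDiffOn ℝ ∞ (tubeParam : F → ℝ) {0}ᶜ :=
  (contDiffOn_id.norm ℝ fun x (hx : x ≠ 0) ↦ hx).sub contDiffOn_const

theorem IsTubeProfile.norm_fst_tubeMap (h : IsTubeProfile r z) (hy : y ≠ 0) :
    ‖(tubeMap r z y : F × ℝ × G).1‖ = r (tubeParam y) := by
  rw [tubeMap, norm_smul, norm_direction hy, mul_one, Real.norm_of_nonneg (h.r_pos _).le]

theorem IsTubeProfile.injOn_tubeMap (h : IsTubeProfile r z) :
    InjOn (tubeMap r z : F → F × ℝ × G) {0}ᶜ := by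
  intro x (hx : x ≠ 0) y (hy : y ≠ 0) hxy
  have hr : r (tubeParam x) = r (tubeParam y) := by
    rw [← h.norm_fst_tubeMap (G := G) hx, hxy, h.norm_fst_tubeMap hy]
  have ht : tubeParam x = tubeParam y :=
    h.injective (Prod.ext hr (congrArg (fun q ↦ q.2.1) hxy))
  have hu : direction x = direction y := smul_right_injective F (h.r_pos (tubeParam x)).ne'
    (by simpa only [tubeMap, ht] using congrArg Prod.fst hxy)
  rw [← norm_smul_direction x, ← norm_smul_direction y, hu, sub_left_injective ht]

theorem IsTubeProfile.image_tubeMap (h : IsTubeProfile r z) :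
    (tubeMap r z : F → F × ℝ × G) '' tubeDomain =
      {q | ∃ t ∈ Ioo (-2 : ℝ) 2, ‖q.1‖ = r t ∧ q.2.1 = z t ∧ q.2.2 = 0} := by
  ext q
  constructor
  · rintro ⟨y, hy, rfl⟩
    exact ⟨tubeParam y, abs_lt.1 (abs_tubeParam_lt hy),
      h.norm_fst_tubeMap (ne_zero_of_mem_tubeDomain hy), rfl, rfl⟩
  · rintro ⟨t, ht, hr, hz, hw⟩
    have hq : q.1 ≠ 0 := norm_pos_iff.1 (hr ▸ h.r_pos t)
    have hpos : 0 < t + 3 := by linarith [ht.1]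
    have hnorm : ‖(t + 3) • direction q.1‖ = t + 3 := by
      rw [norm_smul, norm_direction hq, mul_one, Real.norm_of_nonneg hpos.le]
    have hparam : tubeParam ((t + 3) • direction q.1) = t := by
      rw [tubeParam, hnorm, add_sub_cancel_right]
    refine ⟨(t + 3) • direction q.1, ?_, Prod.ext ?_ (Prod.ext ?_ hw.symm)⟩
    · change ‖(t + 3) • direction q.1‖ ∈ Ioo 1 5
      rw [hnorm]
      exact ⟨by linarith [ht.1], by linarith [ht.2]⟩
    · rw [tubeMap, hparam, direction_smul hpos (norm_direction hq), ← hr, norm_smul_direction]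
    · rw [tubeMap, hparam, hz]

variable [NormedSpace ℝ G]

theorem IsTubeProfile.contDiffOn_tubeMap (h : IsTubeProfile r z) :
    ContDiffOn ℝ ∞ (tubeMap r z : F → F × ℝ × G) {0}ᶜ :=
  ((h.smooth_r.comp_contDiffOn contDiffOn_tubeParam).smul contDiffOn_direction).prodMk <|
    (h.smooth_z.comp_contDiffOn contDiffOn_tubeParam).prodMk contDiffOn_const

theorem IsTubeProfile.hasFDerivAt_tubeMap (h : IsTubeProfile r z) (hy : y ≠ 0) :
    HasFDerivAt (tubeMap r z : F → F × ℝ × G)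
      ((r (tubeParam y) • ‖y‖⁻¹ •
          (.id ℝ F - (innerSL ℝ (direction y)).smulRight (direction y)) +
        (deriv r (tubeParam y) • innerSL ℝ (direction y)).smulRight (direction y)).prod
      ((deriv z (tubeParam y) • innerSL ℝ (direction y)).prod 0)) y := by
  have ht : HasFDerivAt tubeParam (innerSL ℝ (direction y)) y :=
    (hasFDerivAt_norm hy).sub_const 3
  exact (((h.hasDerivAt_r _).comp_hasFDerivAt y ht).smul (hasFDerivAt_direction hy)).prodMk
    (((h.hasDerivAt_z _).comp_hasFDerivAt y ht).prodMk (hasFDerivAt_const 0 y))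

theorem IsTubeProfile.differential_tubeMap (h : IsTubeProfile r z) (hy : y ∈ tubeDomain) (v : F) :
    differential 𝓘(ℝ, F) 𝓘(ℝ, F × ℝ × G) (tubeMap r z : F → F × ℝ × G) tubeDomain y v =
      (r (tubeParam y) • ‖y‖⁻¹ • (v - inner ℝ (direction y) v • direction y) +
        (deriv r (tubeParam y) * inner ℝ (direction y) v) • direction y,
      deriv z (tubeParam y) * inner ℝ (direction y) v, 0) := by
  rw [differential_eq_fderivWithin, fderivWithin_of_isOpen isOpen_tubeDomain hy,
    (h.hasFDerivAt_tubeMap (G := G) (ne_zero_of_mem_tubeDomain hy)).fderiv]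
  rfl

theorem IsTubeProfile.injective_differential_tubeMap (h : IsTubeProfile r z)
    (hy : y ∈ tubeDomain) : Function.Injective
      (differential 𝓘(ℝ, F) 𝓘(ℝ, F × ℝ × G) (tubeMap r z : F → F × ℝ × G) tubeDomain y) := by
  have hy₀ := ne_zero_of_mem_tubeDomain hy
  refine (injective_iff_map_eq_zero _).2 fun v hv ↦ ?_
  rw [h.differential_tubeMap hy, Prod.mk_eq_zero, Prod.mk_eq_zero] at hv
  obtain ⟨h₁, h₂, -⟩ := hv
  have hradial : inner ℝ (direction y) v = (0 : ℝ) := by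
    rcases h.regular (tubeParam y) with hr | hz
    · have := congrArg (inner ℝ (direction y)) h₁
      simpa only [inner_add_right, inner_sub_right, real_inner_smul_right,
        inner_direction_self hy₀, mul_one, sub_self, mul_zero, zero_add, inner_zero_right,
        mul_eq_zero, hr, false_or] using this
    · exact (mul_eq_zero.1 h₂).resolve_left hz
  simpa [hradial, (h.r_pos _).ne', hy₀] using h₁

theorem IsTubeProfile.isEmbeddedOn_tubeMap [FiniteDimensional ℝ F] (h : IsTubeProfile r z) :
    IsEmbeddedOn 𝓘(ℝ, F) 𝓘(ℝ, F × ℝ × G) (tubeMap r z : F → F × ℝ × G) tubeDomain where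
  uniqueMDiffOn := isOpen_tubeDomain.uniqueMDiffOn
  smooth := (h.contDiffOn_tubeMap.mono fun _ ↦ ne_zero_of_mem_tubeDomain).contMDiffOn
  isEmbedding := by
    have : ProperSpace F := FiniteDimensional.proper_real F
    have hK : IsCompact (closedBall (0 : F) 5 \ ball 0 1) :=
      (isCompact_closedBall 0 5).diff isOpen_ball
    have hK₀ : closedBall (0 : F) 5 \ ball 0 1 ⊆ {0}ᶜ := by
      rintro _ ⟨-, hy⟩ rfl
      exact hy (mem_ball_self one_pos)
    refine isEmbedding_domRestrict_of_isCompact hK (h.contDiffOn_tubeMap.continuousOn.mono hK₀)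
      (h.injOn_tubeMap.mono hK₀) fun y hy ↦ ⟨?_, ?_⟩
    · exact mem_closedBall_zero_iff.2 hy.2.le
    · exact fun hy' ↦ (mem_ball_zero_iff.1 hy').not_gt hy.1
  immersive _ hy := h.injective_differential_tubeMap hy

end TubeMap

section Cutoff

/-- A smooth function that is `1` below `-7/4` and `0` above `-5/4`; it localizes data on the tube
to its incoming collar. -/
noncomputable def cutoff (t : ℝ) : ℝ := Real.smoothTransition (-2 * t - 5 / 2)

theorem contDiff_cutoff : ContDiff ℝ ∞ cutoff :=
  Real.smoothTransition.contDiff.comp ((contDiff_const.mul contDiff_id).sub contDiff_const)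

theorem cutoff_of_le {t : ℝ} (ht : t ≤ -(7 / 4)) : cutoff t = 1 :=
  Real.smoothTransition.one_of_one_le (by linarith)

theorem cutoff_of_ge {t : ℝ} (ht : -(5 / 4) ≤ t) : cutoff t = 0 :=
  Real.smoothTransition.zero_of_nonpos (by linarith)

variable {F : Type*} [NormedAddCommGroup F] [InnerProductSpace ℝ F]

/-- The point of the plane `z = 0` from which the field at parameter `t` and direction `u` is
copied: the tube point itself on the incoming collar, and the axis from `t = -5/4` on. -/
noncomputable def footPoint (t : ℝ) (u : F) : F := (cutoff t * -t) • u

theorem footPoint_of_le {t : ℝ} (ht : t ≤ -(7 / 4)) (u : F) : footPoint t u = -t • u := by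
  rw [footPoint, cutoff_of_le ht, one_mul]

theorem footPoint_of_ge {t : ℝ} (ht : -(5 / 4) ≤ t) (u : F) : footPoint t u = 0 := by
  rw [footPoint, cutoff_of_ge ht, zero_mul, zero_smul]

theorem footPoint_mem {t : ℝ} (ht : |t| < 2) {u : F} (hu : ‖u‖ = 1) :
    footPoint t u ∈ ball (0 : F) 2 := by
  have h₀ : 0 ≤ cutoff t := Real.smoothTransition.nonneg _
  rw [mem_ball_zero_iff, footPoint, norm_smul, hu, mul_one, Real.norm_eq_abs, abs_mul, abs_neg,
    abs_of_nonneg h₀]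
  exact (mul_le_of_le_one_left (abs_nonneg t) (Real.smoothTransition.le_one _)).trans_lt ht

theorem contDiffOn_footPoint {T : Set F} {t : F → ℝ} {u : F → F} (ht : ContDiffOn ℝ ∞ t T)
    (hu : ContDiffOn ℝ ∞ u T) : ContDiffOn ℝ ∞ (fun y ↦ footPoint (t y) (u y)) T :=
  ((contDiff_cutoff.comp_contDiffOn ht).mul ht.neg).smul hu

end Cutoff

section TubeField

variable {F G : Type*} [NormedAddCommGroup F] [InnerProductSpace ℝ F] {r z : ℝ → ℝ} {y : F}

/-- The component along the planes, on the two collars of the tube, of the field that interpolates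
between `a` on the plane `z = 0` and `b` on the plane `z = 1`. -/
noncomputable def tubeTangential (a b : F → F) (y : F) : F :=
  cutoff (tubeParam y) • a (footPoint (tubeParam y) (direction y)) +
    cutoff (-tubeParam y) • b (footPoint (-tubeParam y) (direction y))

theorem IsTubeProfile.deriv_smul_tubeTangential (h : IsTubeProfile r z) {a b : F → F} :
    deriv z (tubeParam y) • tubeTangential a b y = 0 := by
  rcases lt_or_ge (tubeParam y) (-(5 / 4)) with h₁ | h₁
  · rw [(h.deriv_of_lt (by linarith)).2, zero_smul]
  rcases lt_or_ge (5 / 4) (tubeParam y) with h₂ | h₂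
  · rw [(h.deriv_of_gt (by linarith)).2, zero_smul]
  rw [tubeTangential, cutoff_of_ge h₁, cutoff_of_ge (by linarith : -(5 / 4) ≤ -tubeParam y),
    zero_smul, zero_smul, add_zero, smul_zero]

variable [NormedAddCommGroup G] [NormedSpace ℝ G]

/-- The reflection `(s, w) ↦ (-s, w)`: the conormal direction of the tube is `-z` on the incoming
plane and `z` on the outgoing one. -/
def reflectFst : (ℝ × G) ≃L[ℝ] ℝ × G := (ContinuousLinearEquiv.neg ℝ).prodCongr (.refl ℝ G)

/-- The component transverse to the tube of the field that interpolates between `a` on the plane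
`z = 0` and `b` on the plane `z = 1`. -/
noncomputable def tubeTransverse (a b : F → ℝ × G) (y : F) : ℝ × G :=
  reflectFst (a (footPoint (tubeParam y) (direction y))) +
    b (footPoint (-tubeParam y) (direction y)) - b 0

theorem tubeTransverse_of_nonpos {a b : F → ℝ × G} (hy : tubeParam y ≤ 0) :
    tubeTransverse a b y = reflectFst (a (footPoint (tubeParam y) (direction y))) := by
  rw [tubeTransverse, footPoint_of_ge (by linarith : -(5 / 4) ≤ -tubeParam y), add_sub_cancel_right]

theorem tubeTransverse_of_nonneg {a b : F → ℝ × G} (hab : b 0 = reflectFst (a 0))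
    (hy : 0 ≤ tubeParam y) :
    tubeTransverse a b y = b (footPoint (-tubeParam y) (direction y)) := by
  rw [tubeTransverse, footPoint_of_ge (by linarith : -(5 / 4) ≤ tubeParam y), hab,
    add_sub_cancel_left]

/-- The field along the tube that interpolates between `a` on the plane `z = 0` and `b` on the plane
`z = 1`. Its transverse component is expanded in the normal `(-z', r')` of the profile. -/
noncomputable def tubeField (r z : ℝ → ℝ) (a b : F → F × ℝ × G) (y : F) : F × ℝ × G :=
  let A := tubeTransverse (fun x ↦ (a x).2) (fun x ↦ (b x).2) y
  (tubeTangential (fun x ↦ (a x).1) (fun x ↦ (b x).1) y -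
      (A.1 * deriv z (tubeParam y)) • direction y,
    A.1 * deriv r (tubeParam y), A.2)

/-- The projection of the model space along the tangent planes of the tube at parameter `t` and
direction `u`. -/
noncomputable def tubeConormal (r z : ℝ → ℝ) (t : ℝ) (u : F) : F × ℝ × G →L[ℝ] ℝ × G :=
  ((deriv r t ^ 2 + deriv z t ^ 2)⁻¹ • (deriv r t • (.fst ℝ ℝ G ∘L .snd ℝ F (ℝ × G)) -
    deriv z t • (innerSL ℝ u ∘L .fst ℝ F (ℝ × G)))).prod (.snd ℝ ℝ G ∘L .snd ℝ F (ℝ × G))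

theorem tubeConormal_apply (t : ℝ) (u : F) (q : F × ℝ × G) : tubeConormal r z t u q =
    ((deriv r t ^ 2 + deriv z t ^ 2)⁻¹ * (deriv r t * q.2.1 - deriv z t * inner ℝ u q.1), q.2.2) :=
  rfl

theorem IsTubeProfile.tubeConormal_differential (h : IsTubeProfile r z) (hy : y ∈ tubeDomain)
    (v : F) : tubeConormal r z (tubeParam y) (direction y)
      (differential 𝓘(ℝ, F) 𝓘(ℝ, F × ℝ × G) (tubeMap r z : F → F × ℝ × G) tubeDomain y v) = 0 := by
  rw [h.differential_tubeMap hy, tubeConormal_apply]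
  refine Prod.ext ?_ rfl
  simp only [inner_add_right, inner_sub_right, real_inner_smul_right,
    inner_direction_self (ne_zero_of_mem_tubeDomain hy), Prod.fst_zero]
  ring

variable {a b : F → F × ℝ × G}

theorem IsTubeProfile.tubeConormal_tubeField (h : IsTubeProfile r z) (hy : y ≠ 0) :
    tubeConormal r z (tubeParam y) (direction y) (tubeField r z a b y) =
      tubeTransverse (fun x ↦ (a x).2) (fun x ↦ (b x).2) y := by
  have hpos : deriv r (tubeParam y) ^ 2 + deriv z (tubeParam y) ^ 2 ≠ 0 := fun h₀ ↦
    (h.regular (tubeParam y)).elim (fun hr ↦ hr (by nlinarith)) fun hz ↦ hz (by nlinarith)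
  have htangential : deriv z (tubeParam y) * inner ℝ (direction y)
      (tubeTangential (fun x ↦ (a x).1) (fun x ↦ (b x).1) y) = 0 := by
    rw [← real_inner_smul_right, h.deriv_smul_tubeTangential, inner_zero_right]
  refine Prod.ext ?_ rfl
  simp only [tubeConormal_apply, tubeField, inner_sub_right, real_inner_smul_right,
    inner_direction_self hy]
  rw [inv_mul_eq_iff_eq_mul₀ hpos]
  linear_combination -htangential

theorem IsTubeProfile.contDiffOn_tubeField (h : IsTubeProfile r z)
    (ha : ContDiffOn ℝ ∞ a (ball 0 2)) (hb : ContDiffOn ℝ ∞ b (ball 0 2)) :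
    ContDiffOn ℝ ∞ (tubeField r z a b) tubeDomain := by
  have ht : ContDiffOn ℝ ∞ tubeParam (tubeDomain : Set F) :=
    contDiffOn_tubeParam.mono fun _ ↦ ne_zero_of_mem_tubeDomain
  have hu : ContDiffOn ℝ ∞ direction (tubeDomain : Set F) :=
    contDiffOn_direction.mono fun _ ↦ ne_zero_of_mem_tubeDomain
  have ha' := ha.comp (contDiffOn_footPoint ht hu) fun y hy ↦
    footPoint_mem (abs_tubeParam_lt hy) (norm_direction (ne_zero_of_mem_tubeDomain hy))
  have hb' := hb.comp (contDiffOn_footPoint ht.neg hu) fun y hy ↦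
    footPoint_mem ((abs_neg _).trans_lt (abs_tubeParam_lt hy))
      (norm_direction (ne_zero_of_mem_tubeDomain hy))
  have hA := ((reflectFst.contDiff.comp_contDiffOn ha'.snd).add hb'.snd).sub
    (contDiffOn_const (c := (b 0).2))
  have hr' := (contDiff_infty_iff_deriv.1 h.smooth_r).2.comp_contDiffOn ht
  have hz' := (contDiff_infty_iff_deriv.1 h.smooth_z).2.comp_contDiffOn ht
  exact ((((contDiff_cutoff.comp_contDiffOn ht).smul ha'.fst).add
    ((contDiff_cutoff.comp_contDiffOn ht.neg).smul hb'.fst)).sub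
      ((hA.fst.mul hz').smul hu)).prodMk ((hA.fst.mul hr').prodMk hA.snd)

theorem IsTubeProfile.param_lt_or_gt (h : IsTubeProfile r z) {t : ℝ} (ht : 1 < r t) :
    t < -1 ∨ 1 < t := by
  by_contra! hmid
  exact (h.r_le_one hmid.1 hmid.2).not_gt ht

theorem IsTubeProfile.tubeField_eq_incoming (h : IsTubeProfile r z) (hy : y ∈ tubeDomain)
    (hr : 7 / 4 ≤ ‖(tubeMap r z y : F × ℝ × G).1‖) (hz : (tubeMap r z y : F × ℝ × G).2.1 = 0) :
    tubeField r z a b y = a (tubeMap r z y : F × ℝ × G).1 := by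
  rw [h.norm_fst_tubeMap (ne_zero_of_mem_tubeDomain hy)] at hr
  change z (tubeParam y) = 0 at hz
  have hlt : tubeParam y < -1 := (h.param_lt_or_gt (by linarith)).resolve_right fun hgt ↦ by
    rw [(h.outgoing _ hgt.le).2] at hz
    exact one_ne_zero hz
  obtain ⟨hr', hz'⟩ := h.deriv_of_lt hlt
  rw [(h.incoming _ hlt.le).1] at hr
  have hfoot : footPoint (tubeParam y) (direction y) = (tubeMap r z y : F × ℝ × G).1 := by
    rw [footPoint_of_le (by linarith), tubeMap, (h.incoming _ hlt.le).1]
  simp only [tubeField, tubeTangential, tubeTransverse_of_nonpos (by linarith : tubeParam y ≤ 0),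
    hfoot, cutoff_of_le (by linarith : tubeParam y ≤ -(7 / 4)),
    cutoff_of_ge (by linarith : -(5 / 4) ≤ -tubeParam y), hr', hz']
  simp [reflectFst]

theorem IsTubeProfile.tubeField_eq_outgoing (h : IsTubeProfile r z) (hy : y ∈ tubeDomain)
    (hab : (b 0).2 = reflectFst (a 0).2)
    (hr : 7 / 4 ≤ ‖(tubeMap r z y : F × ℝ × G).1‖) (hz : (tubeMap r z y : F × ℝ × G).2.1 = 1) :
    tubeField r z a b y = b (tubeMap r z y : F × ℝ × G).1 := by
  rw [h.norm_fst_tubeMap (ne_zero_of_mem_tubeDomain hy)] at hr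
  change z (tubeParam y) = 1 at hz
  have hgt : 1 < tubeParam y := (h.param_lt_or_gt (by linarith)).resolve_left fun hlt ↦ by
    rw [(h.incoming _ hlt.le).2] at hz
    exact zero_ne_one hz
  obtain ⟨hr', hz'⟩ := h.deriv_of_gt hgt
  rw [(h.outgoing _ hgt.le).1] at hr
  have hfoot : footPoint (-tubeParam y) (direction y) = (tubeMap r z y : F × ℝ × G).1 := by
    rw [footPoint_of_le (by linarith), neg_neg, tubeMap, (h.outgoing _ hgt.le).1]
  simp only [tubeField, tubeTangential,
    tubeTransverse_of_nonneg (a := fun x ↦ (a x).2) (b := fun x ↦ (b x).2) hab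
      (by linarith : 0 ≤ tubeParam y),
    hfoot, cutoff_of_le (by linarith : -tubeParam y ≤ -(7 / 4)),
    cutoff_of_ge (by linarith : -(5 / 4) ≤ tubeParam y), hr', hz']
  simp

theorem linearIndependent_tubeTransverse {κ : Type*} {a b : κ → F → ℝ × G}
    (ha : ∀ x ∈ ball 0 2, LinearIndependent ℝ fun i ↦ a i x)
    (hb : ∀ x ∈ ball 0 2, LinearIndependent ℝ fun i ↦ b i x)
    (hab : ∀ i, b i 0 = reflectFst (a i 0)) (hy : y ∈ tubeDomain) :
    LinearIndependent ℝ fun i ↦ tubeTransverse (a i) (b i) y := by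
  have hu := norm_direction (ne_zero_of_mem_tubeDomain hy)
  rcases le_total (tubeParam y) 0 with ht | ht
  · simp only [tubeTransverse_of_nonpos ht]
    exact (ha _ (footPoint_mem (abs_tubeParam_lt hy) hu)).map' _
      (LinearMap.ker_eq_bot.2 reflectFst.injective)
  · simp only [tubeTransverse_of_nonneg (hab _) ht]
    exact hb _ (footPoint_mem ((abs_neg _).trans_lt (abs_tubeParam_lt hy)) hu)

theorem IsTubeProfile.isNormalFrame_tubeField [FiniteDimensional ℝ F] [FiniteDimensional ℝ G]
    {κ : Type*} [Fintype κ] (hκ : Fintype.card κ = 1 + Module.finrank ℝ G) (h : IsTubeProfile r z)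
    {a b : κ → F → F × ℝ × G}
    (ha : ∀ i, ContDiffOn ℝ ∞ (a i) (ball 0 2)) (hb : ∀ i, ContDiffOn ℝ ∞ (b i) (ball 0 2))
    (ha' : ∀ x ∈ ball 0 2, LinearIndependent ℝ fun i ↦ (a i x).2)
    (hb' : ∀ x ∈ ball 0 2, LinearIndependent ℝ fun i ↦ (b i x).2)
    (hab : ∀ i, (b i 0).2 = reflectFst (a i 0).2) :
    IsNormalFrame 𝓘(ℝ, F) 𝓘(ℝ, F × ℝ × G) (tubeMap r z : F → F × ℝ × G) tubeDomain tubeDomain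
      fun i ↦ tubeField r z (a i) (b i) where
  smooth i := smoothAlong_vectorSpace_iff.2
    ⟨h.isEmbeddedOn_tubeMap.smooth, (h.contDiffOn_tubeField (ha i) (hb i)).contMDiffOn⟩
  bijective y hy := by
    refine bijective_frameMap_of_injective (by simp [hκ]; ring) <|
      injective_frameMap_of_linearIndependent (h.injective_differential_tubeMap hy)
        (tubeConormal r z (tubeParam y) (direction y)).toLinearMap
        (h.tubeConormal_differential hy) ?_
    simpa only [ContinuousLinearMap.coe_coe,
      h.tubeConormal_tubeField (ne_zero_of_mem_tubeDomain hy)] using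
      linearIndependent_tubeTransverse ha' hb' hab hy

end TubeField

/-! ### Gluing normal frames along the tube -/

section TubeBlock

/-- A compact block of the local model that contains the tube. Outside of it, the tubed surface
agrees with the planes `z = 0` and `z = 1`. -/
def tubeBlock : Set Model := closedBall 0 (7 / 4) ×ˢ Icc 0 1 ×ˢ {0}

theorem isCompact_tubeBlock : IsCompact tubeBlock :=
  (isCompact_closedBall _ _).prod (isCompact_Icc.prod isCompact_singleton)

theorem tubeBlock_subset_modelBox : tubeBlock ⊆ modelBox := by
  rintro ⟨x, z, w⟩ ⟨hx, hz, rfl⟩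
  have hx' : ‖x‖ ≤ 7 / 4 := mem_closedBall_zero_iff.1 hx
  refine ⟨hx'.trans_lt (by norm_num), by linarith [hz.1], by linarith [hz.2], ?_⟩
  simp

theorem sheet_mem_modelBox {h : ℝ} (h₁ : -1 < h) (h₂ : h < 2) {y : Euc 2} (hy : y ∈ ball 0 2) :
    sheet h y ∈ modelBox :=
  ⟨mem_ball_zero_iff.1 hy, h₁, h₂, by simp [sheet]⟩

variable {r z : ℝ → ℝ}

theorem IsTubeProfile.z_mem_Icc (h : IsTubeProfile r z) (t : ℝ) : z t ∈ Icc (0 : ℝ) 1 := by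
  rcases le_or_gt t (-1) with h₁ | h₁
  · simp [(h.incoming t h₁).2]
  rcases lt_or_ge t 1 with h₂ | h₂
  · exact (h.middle t h₁ h₂).2.2
  · simp [(h.outgoing t h₂).2]

theorem IsTubeProfile.r_lt_two (h : IsTubeProfile r z) {t : ℝ} (ht : t ∈ Ioo (-2) 2) :
    r t < 2 := by
  rcases le_or_gt t (-1) with h₁ | h₁
  · linarith [(h.incoming t h₁).1, ht.1]
  rcases lt_or_ge t 1 with h₂ | h₂
  · linarith [(h.middle t h₁ h₂).2.1]
  · linarith [(h.outgoing t h₂).1, ht.2]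

theorem IsTubeProfile.tubeMap_mem_modelBox (h : IsTubeProfile r z) {y : Euc 2}
    (hy : y ∈ tubeDomain) : tubeMap r z y ∈ modelBox := by
  have hz := h.z_mem_Icc (tubeParam y)
  refine ⟨?_, neg_one_lt_zero.trans_le hz.1, hz.2.trans_lt one_lt_two, by simp [tubeMap]⟩
  rw [h.norm_fst_tubeMap (ne_zero_of_mem_tubeDomain hy)]
  exact h.r_lt_two (abs_lt.1 (abs_tubeParam_lt hy))

theorem IsTubeProfile.norm_fst_ge_of_notMem (h : IsTubeProfile r z) {y : Euc 2}
    (hy : tubeMap r z y ∉ tubeBlock) : 7 / 4 ≤ ‖(tubeMap r z y : Model).1‖ := by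
  by_contra! hlt
  exact hy ⟨mem_closedBall_zero_iff.2 hlt.le, h.z_mem_Icc (tubeParam y), rfl⟩

theorem IsTubeProfile.modelTube_subset_tubeBlock (h : IsTubeProfile r z) :
    modelTube r z ⊆ tubeBlock := by
  rintro ⟨x, s, w⟩ ⟨t, ht, hx, rfl, rfl⟩
  refine ⟨mem_closedBall_zero_iff.2 ?_, h.z_mem_Icc t, rfl⟩
  exact hx.trans_le ((h.r_le_one ht.1 ht.2).trans (by norm_num))

theorem IsTubeProfile.modelTube_subset_image_tubeMap (h : IsTubeProfile r z) :
    modelTube r z ⊆ tubeMap r z '' tubeDomain := by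
  rw [h.image_tubeMap]
  rintro q ⟨t, ht, hq⟩
  exact ⟨t, ⟨by linarith [ht.1], by linarith [ht.2]⟩, hq⟩

theorem IsTubeProfile.mem_image_tubeMap_of_incoming (h : IsTubeProfile r z) {q : Model}
    (hq : q ∈ modelBox) (hz : q.2.1 = 0) (hw : q.2.2 = 0) (hd : q ∉ modelDisk 0) :
    q ∈ tubeMap r z '' tubeDomain := by
  have hq₁ : 1 ≤ ‖q.1‖ := not_lt.1 fun hlt ↦ hd ⟨hlt, hz, hw⟩
  obtain ⟨hr, hz'⟩ := h.incoming (-‖q.1‖) (neg_le_neg hq₁)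
  rw [h.image_tubeMap]
  exact ⟨-‖q.1‖, ⟨neg_lt_neg hq.1, by linarith⟩, by rw [hr, neg_neg], by rw [hz', hz], hw⟩

theorem IsTubeProfile.mem_image_tubeMap_of_outgoing (h : IsTubeProfile r z) {q : Model}
    (hq : q ∈ modelBox) (hz : q.2.1 = 1) (hw : q.2.2 = 0) (hd : q ∉ modelDisk 1) :
    q ∈ tubeMap r z '' tubeDomain := by
  have hq₁ : 1 ≤ ‖q.1‖ := not_lt.1 fun hlt ↦ hd ⟨hlt, hz, hw⟩
  obtain ⟨hr, hz'⟩ := h.outgoing ‖q.1‖ hq₁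
  rw [h.image_tubeMap]
  exact ⟨‖q.1‖, ⟨by linarith, hq.1⟩, hr.symm, by rw [hz', hz], hw⟩

end TubeBlock

section TubingChart

variable {H W : Type*} [TopologicalSpace H] {I : ModelWithCorners ℝ (Euc 5) H}
  [TopologicalSpace W] [ChartedSpace H W] {f f' : Euc 2 → W} {R : Sph → W}
  {Ψ : OpenPartialHomeomorph Model W} {r z : ℝ → ℝ}

/-- The data of `IsTubing`: `Ψ` is the chart around the arc and `(r, z)` the profile of the tube
along which `f` is tubed to `R`, with result `f'`. -/
structure IsTubingChart (I : ModelWithCorners ℝ (Euc 5) H) (f : Euc 2 → W) (R : Sph → W)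
    (f' : Euc 2 → W) (Ψ : OpenPartialHomeomorph Model W) (r z : ℝ → ℝ) : Prop where
  source_eq : Ψ.source = modelBox
  smooth : ContMDiffOn 𝓘(ℝ, Model) I ∞ Ψ Ψ.source
  smooth_symm : ContMDiffOn I 𝓘(ℝ, Model) ∞ Ψ.symm Ψ.target
  mem_disk_iff : ∀ q ∈ modelBox, Ψ q ∈ f '' disk ↔ q.2.1 = 0 ∧ q.2.2 = 0
  mem_sphere_iff : ∀ q ∈ modelBox, Ψ q ∈ range R ↔ q.2.1 = 1 ∧ q.2.2 = 0
  disjoint_boundary : Disjoint Ψ.target (f '' sphere 0 1)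
  profile : IsTubeProfile r z
  image_eq : f' '' disk = (f '' disk \ Ψ '' modelDisk 0) ∪ (range R \ Ψ '' modelDisk 1) ∪
    Ψ '' modelTube r z

theorem IsTubing.exists_isTubingChart (h : IsTubing I f R f') :
    ∃ Ψ r z, IsTubingChart I f R f' Ψ r z :=
  let ⟨_, _, Ψ, r, z, h₁, h₂, h₃, h₄, h₅, h₆, h₇, h₈⟩ := h
  ⟨Ψ, r, z, h₁, h₂, h₃, h₄, h₅, h₆, h₇, h₈⟩

namespace IsTubingChart

theorem mapsTo_sheet (h : IsTubingChart I f R f' Ψ r z) {s : ℝ} (h₁ : -1 < s) (h₂ : s < 2) :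
    MapsTo (sheet s : Euc 2 → Model) (ball 0 2) Ψ.source :=
  fun _ hy ↦ h.source_eq ▸ sheet_mem_modelBox h₁ h₂ hy

theorem mapsTo_tubeMap (h : IsTubingChart I f R f' Ψ r z) :
    MapsTo (tubeMap r z : Euc 2 → Model) tubeDomain Ψ.source :=
  fun _ hy ↦ h.source_eq ▸ h.profile.tubeMap_mem_modelBox hy

theorem sheet_zero_mem_disk (h : IsTubingChart I f R f' Ψ r z) {y : Euc 2} (hy : y ∈ ball 0 2) :
    Ψ (sheet 0 y) ∈ f '' disk :=
  (h.mem_disk_iff _ (sheet_mem_modelBox (by norm_num) (by norm_num) hy)).2 ⟨rfl, rfl⟩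

theorem sheet_one_mem_sphere (h : IsTubingChart I f R f' Ψ r z) {y : Euc 2}
    (hy : y ∈ ball 0 2) : Ψ (sheet 1 y) ∈ range R :=
  (h.mem_sphere_iff _ (sheet_mem_modelBox (by norm_num) (by norm_num) hy)).2 ⟨rfl, rfl⟩

theorem tubeBlock_subset_source (h : IsTubingChart I f R f' Ψ r z) : tubeBlock ⊆ Ψ.source :=
  h.source_eq ▸ tubeBlock_subset_modelBox

theorem image_tubeBlock_subset_target (h : IsTubingChart I f R f' Ψ r z) :
    Ψ '' tubeBlock ⊆ Ψ.target :=
  (image_mono h.tubeBlock_subset_source).trans Ψ.image_source_eq_target.subset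

theorem isClosed_image_tubeBlock [T2Space W] (h : IsTubingChart I f R f' Ψ r z) :
    IsClosed (Ψ '' tubeBlock) :=
  (isCompact_tubeBlock.image_of_continuousOn
    (Ψ.continuousOn.mono h.tubeBlock_subset_source)).isClosed

theorem isOpen_compl_range_union [T2Space W] (h : IsTubingChart I f R f' Ψ r z)
    (hR : Continuous R) : IsOpen (range R ∪ Ψ '' tubeBlock)ᶜ :=
  ((isCompact_range hR).isClosed.union h.isClosed_image_tubeBlock).isOpen_compl

theorem image_modelTube_subset (h : IsTubingChart I f R f' Ψ r z) :
    Ψ '' modelTube r z ⊆ Ψ '' tubeBlock :=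
  image_mono h.profile.modelTube_subset_tubeBlock

theorem image_inter_target_subset (h : IsTubingChart I f R f' Ψ r z) :
    f' '' disk ∩ Ψ.target ⊆ (Ψ ∘ tubeMap r z) '' tubeDomain := by
  rintro p ⟨hp, hpΨ⟩
  obtain ⟨q, hq, rfl⟩ : ∃ q ∈ modelBox, Ψ q = p :=
    ⟨Ψ.symm p, h.source_eq ▸ Ψ.map_target hpΨ, Ψ.right_inv hpΨ⟩
  rw [image_comp]
  rw [h.image_eq] at hp
  obtain (⟨hqf, hqd⟩ | ⟨hqR, hqd⟩) | hqt := hp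
  · obtain ⟨hz, hw⟩ := (h.mem_disk_iff q hq).1 hqf
    exact mem_image_of_mem Ψ (h.profile.mem_image_tubeMap_of_incoming hq hz hw
      fun hd ↦ hqd (mem_image_of_mem Ψ hd))
  · obtain ⟨hz, hw⟩ := (h.mem_sphere_iff q hq).1 hqR
    exact mem_image_of_mem Ψ (h.profile.mem_image_tubeMap_of_outgoing hq hz hw
      fun hd ↦ hqd (mem_image_of_mem Ψ hd))
  · exact image_mono h.profile.modelTube_subset_image_tubeMap hqt

theorem image_inter_compl_subset_disk (h : IsTubingChart I f R f' Ψ r z) :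
    f' '' disk ∩ (range R ∪ Ψ '' tubeBlock)ᶜ ⊆ f '' disk := by
  rintro p ⟨hp, hpR⟩
  rw [h.image_eq] at hp
  obtain (hpf | hpR') | hpt := hp
  · exact hpf.1
  · exact (hpR (.inl hpR'.1)).elim
  · exact (hpR (.inr (h.image_modelTube_subset hpt))).elim

theorem image_inter_compl_subset_sphere (h : IsTubingChart I f R f' Ψ r z) :
    f' '' disk ∩ (f '' disk ∪ Ψ '' tubeBlock)ᶜ ⊆ range R := by
  rintro p ⟨hp, hpf⟩
  rw [h.image_eq] at hp
  obtain (hpf' | hpR) | hpt := hp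
  · exact (hpf (.inl hpf'.1)).elim
  · exact hpR.1
  · exact (hpf (.inr (h.image_modelTube_subset hpt))).elim

theorem image_boundary_subset_compl (h : IsTubingChart I f R f' Ψ r z)
    (hR : Disjoint (range R) (f '' disk)) :
    f '' sphere 0 1 ⊆ (range R ∪ Ψ '' tubeBlock)ᶜ := by
  rintro p hp (hpR | hpΨ)
  · exact disjoint_left.1 hR hpR (image_mono sphere_subset_closedBall hp)
  · exact disjoint_left.1 h.disjoint_boundary (h.image_tubeBlock_subset_target hpΨ) hp

end IsTubingChart

end TubingChart

section Glue

theorem IsNormalFrame.contDiffOn {κ E E' : Type*} [Fintype κ] [NormedAddCommGroup E]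
    [NormedSpace ℝ E] [NormedAddCommGroup E'] [NormedSpace ℝ E'] {f : E → E'} {S T : Set E}
    {V : κ → E → E'} (hV : IsNormalFrame 𝓘(ℝ, E) 𝓘(ℝ, E') f S T V) (i : κ) :
    ContDiffOn ℝ ∞ (V i) T :=
  (smoothAlong_vectorSpace_iff.1 (hV.smooth i)).2.contDiffOn

theorem IsNormalFrame.of_preimage_locally {κ E H M E' H' N : Type*} [Fintype κ]
    [NormedAddCommGroup E] [NormedSpace ℝ E] [TopologicalSpace H]
    [TopologicalSpace M] [ChartedSpace H M]
    [NormedAddCommGroup E'] [NormedSpace ℝ E'] [TopologicalSpace H']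
    [TopologicalSpace N] [ChartedSpace H' N]
    {J : ModelWithCorners ℝ E H} {I : ModelWithCorners ℝ E' H'} [IsManifold I ∞ N]
    {f : M → N} {S T : Set M} {V : κ → M → E'} (hf : ContinuousOn f T)
    (h : ∀ x ∈ T, ∃ O, IsOpen O ∧ f x ∈ O ∧ IsNormalFrame J I f S (T ∩ f ⁻¹' O) V) :
    IsNormalFrame J I f S T V := by
  refine .of_locally fun x hx ↦ ?_
  obtain ⟨O, hO, hxO, hV⟩ := h x hx
  obtain ⟨u, hu, hTu⟩ := continuousOn_iff'.1 hf O hO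
  rw [inter_comm, inter_comm u] at hTu
  exact ⟨u, hu, (hTu.subset ⟨hx, hxO⟩).2, hTu ▸ hV⟩

end Glue

section TubedFrame

variable {H W : Type*} [TopologicalSpace H] {I : ModelWithCorners ℝ (Euc 5) H}
  [TopologicalSpace W] [ChartedSpace H W] {f f' : Euc 2 → W} {R : Sph → W}
  {Ψ : OpenPartialHomeomorph Model W} {r z : ℝ → ℝ} {X Xf XR XΨ : Fin 3 → W → Euc 5}

/-- The vector field `X` on `W`, read in the chart `Ψ` on the plane `z = s`, `w = 0`. -/
noncomputable def sheetField (I : ModelWithCorners ℝ (Euc 5) H)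
    (Ψ : OpenPartialHomeomorph Model W) (s : ℝ) (X : W → Euc 5) (y : Euc 2) : Model :=
  differential I 𝓘(ℝ, Model) Ψ.symm Ψ.target (Ψ (sheet s y)) (X (Ψ (sheet s y)))

namespace IsTubingChart

theorem differential_sheetField (h : IsTubingChart I f R f' Ψ r z) {s : ℝ} {y : Euc 2}
    (hy : sheet s y ∈ Ψ.source) (X : W → Euc 5) :
    differential 𝓘(ℝ, Model) I Ψ Ψ.source (sheet s y) (sheetField I Ψ s X y) =
      X (Ψ (sheet s y)) :=
  DFunLike.congr_fun (differential_comp_differential_symm h.smooth h.smooth_symm hy) _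

theorem exists_glued_field (h : IsTubingChart I f R f' Ψ r z)
    (hXΨ : ∀ p ∈ (Ψ ∘ tubeMap r z) '' tubeDomain, p ∉ Ψ '' tubeBlock → ∀ i,
      (p ∈ f '' disk → XΨ i p = Xf i p) ∧ (p ∈ range R → XΨ i p = XR i p)) :
    ∃ X : Fin 3 → W → Euc 5, (∀ p ∈ Ψ.target, ∀ i, X i p = XΨ i p) ∧
      (∀ p ∈ f' '' disk ∩ (range R ∪ Ψ '' tubeBlock)ᶜ, ∀ i, X i p = Xf i p) ∧
      ∀ p ∈ f' '' disk ∩ (f '' disk ∪ Ψ '' tubeBlock)ᶜ, ∀ i, X i p = XR i p := by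
  classical
  refine ⟨fun i p ↦ if p ∈ Ψ.target then XΨ i p else if p ∈ f '' disk then Xf i p else XR i p,
    fun p hp i ↦ if_pos hp, fun p hp i ↦ ?_, fun p hp i ↦ ?_⟩
  · beta_reduce
    have hpf := h.image_inter_compl_subset_disk hp
    by_cases hpΨ : p ∈ Ψ.target
    · rw [if_pos hpΨ]
      exact (hXΨ p (h.image_inter_target_subset ⟨hp.1, hpΨ⟩) (fun hK ↦ hp.2 (.inr hK)) i).1 hpf
    · rw [if_neg hpΨ, if_pos hpf]
  · beta_reduce
    have hpR := h.image_inter_compl_subset_sphere hp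
    by_cases hpΨ : p ∈ Ψ.target
    · rw [if_pos hpΨ]
      exact (hXΨ p (h.image_inter_target_subset ⟨hp.1, hpΨ⟩) (fun hK ↦ hp.2 (.inr hK)) i).2 hpR
    · rw [if_neg hpΨ, if_neg fun hpf ↦ hp.2 (.inl hpf)]

variable [IsManifold I ∞ W]

theorem isNormalFrame_sheetField {M : Type*} [TopologicalSpace M] [ChartedSpace (Euc 2) M]
    [IsManifold (𝓡 2) ∞ M] [Nonempty M] {g : M → W} {S : Set M}
    (h : IsTubingChart I f R f' Ψ r z) {s : ℝ} (h₁ : -1 < s) (h₂ : s < 2)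
    (hg : IsEmbeddedOn (𝓡 2) I g S) (hX : IsNormalFrame (𝓡 2) I g S S fun i x ↦ X i (g x))
    (hs : MapsTo (Ψ ∘ sheet s) (ball 0 2) (g '' S)) :
    IsNormalFrame (𝓡 2) 𝓘(ℝ, Model) (sheet s : Euc 2 → Model) (ball 0 2) (ball 0 2)
      fun i ↦ sheetField I Ψ s (X i) := by
  have hsheet : MapsTo (sheet s : Euc 2 → Model) (ball 0 2) Ψ.source := h.mapsTo_sheet h₁ h₂
  have hemb := (isEmbeddedOn_sheet (F := Euc 2) (G := Euc 2) s isOpen_ball).diffeo_comp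
    h.smooth h.smooth_symm hsheet
  exact (hX.of_mapsTo_image hg hemb rfl hs).diffeo_comp (Ψ := Ψ.symm) hemb.smooth
    hemb.uniqueMDiffOn h.smooth_symm (by simpa using h.smooth) (Ψ.mapsTo.comp hsheet)
    fun y hy ↦ (Ψ.left_inv (hsheet hy)).symm

theorem exists_isNormalFrame_tubeMap (h : IsTubingChart I f R f' Ψ r z)
    (ha : IsNormalFrame (𝓡 2) 𝓘(ℝ, Model) (sheet 0 : Euc 2 → Model) (ball 0 2) (ball 0 2)
      fun i ↦ sheetField I Ψ 0 (Xf i))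
    (hb : IsNormalFrame (𝓡 2) 𝓘(ℝ, Model) (sheet 1 : Euc 2 → Model) (ball 0 2) (ball 0 2)
      fun i ↦ sheetField I Ψ 1 (XR i))
    (hab : ∀ i, (sheetField I Ψ 1 (XR i) 0).2 = reflectFst (sheetField I Ψ 0 (Xf i) 0).2) :
    ∃ X : Fin 3 → W → Euc 5,
      IsNormalFrame (𝓡 2) I (Ψ ∘ tubeMap r z) tubeDomain tubeDomain
        (fun i y ↦ X i (Ψ (tubeMap r z y))) ∧
      ∀ p ∈ (Ψ ∘ tubeMap r z) '' tubeDomain, p ∉ Ψ '' tubeBlock → ∀ i,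
        (p ∈ f '' disk → X i p = Xf i p) ∧ (p ∈ range R → X i p = XR i p) := by
  have hemb := (h.profile.isEmbeddedOn_tubeMap (F := Euc 2) (G := Euc 2)).diffeo_comp
    h.smooth h.smooth_symm h.mapsTo_tubeMap
  have htube := h.profile.isNormalFrame_tubeField (by simp) ha.contDiffOn hb.contDiffOn
    (fun _ ↦ ha.linearIndependent_snd isOpen_ball)
    (fun _ ↦ hb.linearIndependent_snd isOpen_ball) hab
  have hV := htube.diffeo_comp h.profile.isEmbeddedOn_tubeMap.smooth
    isOpen_tubeDomain.uniqueMDiffOn h.smooth h.smooth_symm h.mapsTo_tubeMap (eqOn_refl _ _)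
  obtain ⟨X, hX⟩ := exists_extend_of_injOn hemb.injOn fun i y ↦
    differential 𝓘(ℝ, Model) I Ψ Ψ.source (tubeMap r z y)
      (tubeField r z (sheetField I Ψ 0 (Xf i)) (sheetField I Ψ 1 (XR i)) y)
  refine ⟨X, hV.congr hX, ?_⟩
  rintro _ ⟨y, hy, rfl⟩ hK i
  have hr := h.profile.norm_fst_ge_of_notMem fun hmem ↦ hK (mem_image_of_mem Ψ hmem)
  have hbox := h.profile.tubeMap_mem_modelBox hy
  have hsource := h.mapsTo_tubeMap hy
  refine ⟨fun hp ↦ (hX y hy i).trans ?_, fun hp ↦ (hX y hy i).trans ?_⟩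
  · obtain ⟨hz, hw⟩ := (h.mem_disk_iff _ hbox).1 hp
    have hsheet : tubeMap r z y = sheet 0 (tubeMap r z y : Model).1 :=
      Prod.ext rfl (Prod.ext hz hw)
    have hXf := h.differential_sheetField (hsheet ▸ hsource) (Xf i)
    rw [h.profile.tubeField_eq_incoming hy hr hz]
    rwa [← hsheet] at hXf
  · obtain ⟨hz, hw⟩ := (h.mem_sphere_iff _ hbox).1 hp
    have hsheet : tubeMap r z y = sheet 1 (tubeMap r z y : Model).1 :=
      Prod.ext rfl (Prod.ext hz hw)
    have hXR := h.differential_sheetField (hsheet ▸ hsource) (XR i)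
    rw [h.profile.tubeField_eq_outgoing hy (hab i) hr hz]
    rwa [← hsheet] at hXR

theorem exists_isNormalFrame_of_matching [T2Space W] (h : IsTubingChart I f R f' Ψ r z)
    (hf : IsEmbeddedDisk I f) (hf' : IsEmbeddedDisk I f') (hR : IsEmbeddedOn (𝓡 2) I R univ)
    (hRf : Disjoint (range R) (f '' disk))
    (hXf : IsNormalFrame (𝓡 2) I f disk disk fun i x ↦ Xf i (f x))
    (hXR : IsNormalFrame (𝓡 2) I R univ univ fun i x ↦ XR i (R x))
    (hXΨ : IsNormalFrame (𝓡 2) I (Ψ ∘ tubeMap r z) tubeDomain tubeDomain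
      fun i y ↦ XΨ i (Ψ (tubeMap r z y)))
    (hfar : ∀ p ∈ (Ψ ∘ tubeMap r z) '' tubeDomain, p ∉ Ψ '' tubeBlock → ∀ i,
      (p ∈ f '' disk → XΨ i p = Xf i p) ∧ (p ∈ range R → XΨ i p = XR i p)) :
    ∃ X : Fin 3 → W → Euc 5, IsNormalFrame (𝓡 2) I f' disk disk (fun i x ↦ X i (f' x)) ∧
      ∀ p ∈ f' '' disk ∩ (range R ∪ Ψ '' tubeBlock)ᶜ, ∀ i, X i p = Xf i p := by
  have hfclosed : IsClosed (f '' disk) :=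
    ((isCompact_closedBall 0 1).image_of_continuousOn hf.smooth.continuousOn).isClosed
  obtain ⟨X, hXt, hXd, hXs⟩ := h.exists_glued_field hfar
  refine ⟨X, .of_preimage_locally hf'.smooth.continuousOn fun x _ ↦ ?_, hXd⟩
  by_cases hxΨ : f' x ∈ Ψ.target
  · have hemb := (h.profile.isEmbeddedOn_tubeMap (F := Euc 2) (G := Euc 2)).diffeo_comp
      h.smooth h.smooth_symm h.mapsTo_tubeMap
    exact ⟨Ψ.target, Ψ.open_target, hxΨ, (hXΨ.of_image_inter_subset hemb hf'.isEmbeddedOn rfl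
      Ψ.open_target h.image_inter_target_subset).congr fun y hy i ↦ hXt _ hy.2 i⟩
  have hxK : f' x ∉ Ψ '' tubeBlock := fun hK ↦ hxΨ (h.image_tubeBlock_subset_target hK)
  by_cases hxR : f' x ∈ range R
  · have : Nonempty Sph := ⟨hxR.choose⟩
    have hO : IsOpen (f '' disk ∪ Ψ '' tubeBlock)ᶜ :=
      (hfclosed.union h.isClosed_image_tubeBlock).isOpen_compl
    refine ⟨_, hO, fun hx ↦ hx.elim (disjoint_left.1 hRf hxR) hxK, ?_⟩
    exact (hXR.of_image_inter_subset hR hf'.isEmbeddedOn rfl hO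
      (image_univ ▸ h.image_inter_compl_subset_sphere)).congr
        fun y hy i ↦ hXs _ ⟨mem_image_of_mem f' hy.1, hy.2⟩ i
  · have hO : IsOpen (range R ∪ Ψ '' tubeBlock)ᶜ :=
      h.isOpen_compl_range_union (continuousOn_univ.1 hR.smooth.continuousOn)
    refine ⟨_, hO, fun hx ↦ hx.elim hxR hxK, ?_⟩
    exact (hXf.of_image_inter_subset hf.isEmbeddedOn hf'.isEmbeddedOn rfl hO
      h.image_inter_compl_subset_disk).congr
        fun y hy i ↦ hXd _ ⟨mem_image_of_mem f' hy.1, hy.2⟩ i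

end IsTubingChart

end TubedFrame

section Matching

variable {H W : Type*} [TopologicalSpace H] {I : ModelWithCorners ℝ (Euc 5) H}
  [TopologicalSpace W] [T2Space W] [ChartedSpace H W] [IsManifold I ∞ W] {f f' : Euc 2 → W}
  {R : Sph → W} {Ψ : OpenPartialHomeomorph Model W} {r z : ℝ → ℝ} {Xf XR : Fin 3 → W → Euc 5}

theorem IsTubingChart.exists_isNormalFrame_matching (h : IsTubingChart I f R f' Ψ r z)
    (hf : IsEmbeddedDisk I f) (hR : IsEmbeddedOn (𝓡 2) I R univ)
    (hXf : IsNormalFrame (𝓡 2) I f disk disk fun i x ↦ Xf i (f x))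
    (hXR : IsNormalFrame (𝓡 2) I R univ univ fun i x ↦ XR i (R x)) :
    ∃ X : Fin 3 → W → Euc 5, IsNormalFrame (𝓡 2) I R univ univ (fun i x ↦ X i (R x)) ∧
      IsNormalFrame (𝓡 2) 𝓘(ℝ, Model) (sheet 0 : Euc 2 → Model) (ball 0 2) (ball 0 2)
        (fun i ↦ sheetField I Ψ 0 (Xf i)) ∧
      IsNormalFrame (𝓡 2) 𝓘(ℝ, Model) (sheet 1 : Euc 2 → Model) (ball 0 2) (ball 0 2)
        (fun i ↦ sheetField I Ψ 1 (X i)) ∧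
      ∀ i, (sheetField I Ψ 1 (X i) 0).2 = reflectFst (sheetField I Ψ 0 (Xf i) 0).2 := by
  have h0 : (0 : Euc 2) ∈ ball 0 2 := mem_ball_self two_pos
  have : Nonempty Sph := ⟨(h.sheet_one_mem_sphere h0).choose⟩
  have ha := h.isNormalFrame_sheetField (by norm_num) (by norm_num) hf.isEmbeddedOn hXf
    fun y ↦ h.sheet_zero_mem_disk
  have hb {X : Fin 3 → W → Euc 5} (hX : IsNormalFrame (𝓡 2) I R univ univ fun i x ↦ X i (R x)) :=
    h.isNormalFrame_sheetField (by norm_num) (by norm_num) hR hX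
      fun y hy ↦ image_univ (f := R) ▸ h.sheet_one_mem_sphere hy
  obtain ⟨C, hC⟩ := exists_equiv_sum_smul_eq (by simp)
    ((hb hXR).linearIndependent_snd isOpen_ball h0)
    ((ha.linearIndependent_snd isOpen_ball h0).map'
      (reflectFst (G := Euc 2)).toLinearEquiv.toLinearMap (LinearEquiv.ker _))
  have hCXR := hXR.changeBasis C
  refine ⟨fun i p ↦ ∑ j, C (Pi.single i 1) j • XR j p, hCXR, ha, hb hCXR, fun i ↦ ?_⟩
  refine Eq.trans ?_ (hC i)
  simp only [sheetField, map_sum, map_smul, Prod.snd_sum, Prod.smul_snd]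

theorem IsTubingChart.exists_isNormalFrame (h : IsTubingChart I f R f' Ψ r z)
    (hf : IsEmbeddedDisk I f) (hf' : IsEmbeddedDisk I f') (hR : IsEmbeddedOn (𝓡 2) I R univ)
    (hRf : Disjoint (range R) (f '' disk))
    (hXf : IsNormalFrame (𝓡 2) I f disk disk fun i x ↦ Xf i (f x))
    (hXR : IsNormalFrame (𝓡 2) I R univ univ fun i x ↦ XR i (R x)) :
    ∃ X : Fin 3 → W → Euc 5, IsNormalFrame (𝓡 2) I f' disk disk (fun i x ↦ X i (f' x)) ∧
      ∀ p ∈ f' '' disk ∩ (range R ∪ Ψ '' tubeBlock)ᶜ, ∀ i, X i p = Xf i p := by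
  obtain ⟨XR', hXR', ha, hb, hab⟩ := h.exists_isNormalFrame_matching hf hR hXf hXR
  obtain ⟨XΨ, hXΨ, hfar⟩ := h.exists_isNormalFrame_tubeMap ha hb hab
  exact h.exists_isNormalFrame_of_matching hf hf' hR hRf hXf hXR' hXΨ hfar

end Matching

section AgreeOnBoundary

variable {H W : Type*} [TopologicalSpace H] {I : ModelWithCorners ℝ (Euc 5) H}
  [TopologicalSpace W] [ChartedSpace H W] {f f' : Euc 2 → W} {R : Sph → W}
  {V V' : Fin 3 → Euc 2 → Euc 5}

/-- The frames `V` of the disk `f` and `V'` of the disk `f'`, and the tangent planes of the two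
disks, agree at the common points of their boundary circles. -/
structure AgreeOnBoundary (I : ModelWithCorners ℝ (Euc 5) H) (f f' : Euc 2 → W)
    (V V' : Fin 3 → Euc 2 → Euc 5) : Prop where
  frame_eq : ∀ x ∈ sphere (0 : Euc 2) 1, ∀ y ∈ sphere (0 : Euc 2) 1, f' x = f y →
    ∀ i, V' i x = V i y
  range_eq : ∀ x ∈ sphere (0 : Euc 2) 1, ∀ y ∈ sphere (0 : Euc 2) 1, f' x = f y →
    (differential 𝓘(ℝ, Euc 2) I f' disk x).range = (differential 𝓘(ℝ, Euc 2) I f disk y).range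

theorem AgreeOnBoundary.symm (h : AgreeOnBoundary I f f' V V') : AgreeOnBoundary I f' f V' V where
  frame_eq x hx y hy hxy i := (h.frame_eq y hy x hx hxy.symm i).symm
  range_eq x hx y hy hxy := (h.range_eq y hy x hx hxy.symm).symm

theorem IsTubing.exists_isNormalFrame [T2Space W] [IsManifold I ∞ W] (h : IsTubing I f R f')
    (hf : IsEmbeddedDisk I f) (hR : Manifold.IsSmoothEmbedding (𝓡 2) I ∞ R)
    (hRtriv : HasTrivialNormalBundle (𝓡 2) I 3 R) (hRf : Disjoint (range R) (f '' disk))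
    (hV : IsNormalFrame 𝓘(ℝ, Euc 2) I f disk disk V) :
    ∃ V', IsNormalFrame 𝓘(ℝ, Euc 2) I f' disk disk V' ∧ AgreeOnBoundary I f f' V V' := by
  obtain ⟨Ψ, r, z, hΨ⟩ := h.exists_isTubingChart
  have : Nonempty Sph := ⟨(hΨ.sheet_one_mem_sphere (mem_ball_self two_pos)).choose⟩
  have hR' := isEmbeddedOn_univ_of_isSmoothEmbedding hR
  obtain ⟨φ, hφ⟩ := hRtriv
  obtain ⟨VR, hVR⟩ := hφ.exists_isNormalFrame (by simp) hR'.immersive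
  obtain ⟨Xf, hXf⟩ := exists_extend_of_injOn hf.injOn V
  obtain ⟨XR, hXR⟩ := exists_extend_of_injOn hR'.injOn VR
  obtain ⟨X, hX, hXeq⟩ := hΨ.exists_isNormalFrame hf h.1 hR' hRf (hV.congr hXf) (hVR.congr hXR)
  have hO := hΨ.isOpen_compl_range_union hR.isEmbedding.continuous
  have hmem {x : Euc 2} (hx : x ∈ sphere 0 1) : f' x ∈ (range R ∪ Ψ '' tubeBlock)ᶜ :=
    hΨ.image_boundary_subset_compl hRf (h.2.1 ▸ mem_image_of_mem f' hx)
  refine ⟨_, hX, fun x hx y hy hxy i ↦ ?_, fun x hx y hy hxy ↦ ?_⟩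
  · rw [hXeq _ ⟨mem_image_of_mem f' (sphere_subset_closedBall hx), hmem hx⟩, hxy,
      hXf y (sphere_subset_closedBall hy)]
  · exact hf.isEmbeddedOn.range_differential_eq_of_inter_subset h.1.isEmbeddedOn rfl hO
      hΨ.image_inter_compl_subset_disk (sphere_subset_closedBall hx) (sphere_subset_closedBall hy)
      hxy (hmem hx)

end AgreeOnBoundary

/-! ### Transport of framings between disks -/

section LinearAlgebra

theorem linearIndependent_map_of_ker_le {κ E F G : Type*} [AddCommGroup E] [Module ℝ E]
    [AddCommGroup F] [Module ℝ F] [AddCommGroup G] [Module ℝ G] {L : E →ₗ[ℝ] F} {L' : E →ₗ[ℝ] G}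
    (h : L'.ker ≤ L.ker) {v : κ → E} (hv : LinearIndependent ℝ fun i ↦ L (v i)) :
    LinearIndependent ℝ fun i ↦ L' (v i) := by
  refine linearIndependent_iff'.2 fun s c hc ↦ linearIndependent_iff'.1 hv s c ?_
  simp only [← map_smul, ← map_sum] at hc ⊢
  exact h hc

end LinearAlgebra

section NormalCoord

variable {κ E H M E' H' N : Type*} [Fintype κ]
  [NormedAddCommGroup E] [NormedSpace ℝ E] [TopologicalSpace H]
  [TopologicalSpace M] [ChartedSpace H M]
  [NormedAddCommGroup E'] [NormedSpace ℝ E'] [TopologicalSpace H']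
  [TopologicalSpace N] [ChartedSpace H' N]
  {J : ModelWithCorners ℝ E H} {I : ModelWithCorners ℝ E' H'}
  {f : M → N} {S T : Set M} {V : κ → M → E'} {x : M}

/-- The components with respect to `V` of the image of a tangent vector of `N` at `f x` in the
normal space, where `V` is a normal frame of `f`. -/
noncomputable def normalCoord (J : ModelWithCorners ℝ E H) (I : ModelWithCorners ℝ E' H')
    (f : M → N) (S : Set M) (V : κ → M → E') (x : M) : E' →L[ℝ] κ → ℝ :=
  .fst ℝ (κ → ℝ) E ∘L (frameMap J I f S V x).inverse

variable [IsManifold I ∞ N] [FiniteDimensional ℝ E]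

theorem IsNormalFrame.normalCoord_frameMap (hV : IsNormalFrame J I f S T V) (hx : x ∈ T)
    (p : (κ → ℝ) × E) : normalCoord J I f S V x (frameMap J I f S V x p) = p.1 := by
  obtain ⟨e, he⟩ := isInvertible_of_bijective (hV.bijective x hx)
  simp [normalCoord, ← he]

theorem IsNormalFrame.normalCoord_sum (hV : IsNormalFrame J I f S T V) (hx : x ∈ T) (c : κ → ℝ) :
    normalCoord J I f S V x (∑ i, c i • V i x) = c := by
  simpa [frameMap_apply] using hV.normalCoord_frameMap hx (c, 0)

theorem IsNormalFrame.sub_sum_normalCoord_mem_range (hV : IsNormalFrame J I f S T V) (hx : x ∈ T)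
    (w : E') : w - ∑ i, normalCoord J I f S V x w i • V i x ∈ (differential J I f S x).range := by
  obtain ⟨p, rfl⟩ := (hV.bijective x hx).2 w
  refine ⟨p.2, ?_⟩
  rw [hV.normalCoord_frameMap hx, frameMap_apply]
  simp

theorem IsNormalFrame.ker_normalCoord (hV : IsNormalFrame J I f S T V) (hx : x ∈ T) :
    (normalCoord J I f S V x).ker = (differential J I f S x).range := by
  refine le_antisymm (fun w hw ↦ ?_) ?_
  · simpa [show normalCoord J I f S V x w = 0 from hw] using
      hV.sub_sum_normalCoord_mem_range hx w
  · rintro _ ⟨v, rfl⟩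
    simpa [frameMap_apply] using hV.normalCoord_frameMap hx (0, v)

end NormalCoord

section Transport

variable {κ E E' H' N G : Type*} [Fintype κ] [NormedAddCommGroup E] [NormedSpace ℝ E]
  [NormedAddCommGroup E'] [NormedSpace ℝ E'] [TopologicalSpace H'] [TopologicalSpace N]
  [ChartedSpace H' N] [NormedAddCommGroup G] [NormedSpace ℝ G]
  {I : ModelWithCorners ℝ E' H'} {f : E → N} {S : Set E} {f' : G → N} {T : Set G}
  {V : κ → E → E'} {V' : κ → G → E'} {k : G → E}

/-- The vector field along `f'` with the components in the normal frame `V'` that the field `U`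
along `f` has in the normal frame `V`, pulled back by `k`. -/
noncomputable def transportField (I : ModelWithCorners ℝ E' H') (f : E → N) (S : Set E)
    (V : κ → E → E') (V' : κ → G → E') (k : G → E) (U : E → E') (x : G) : E' :=
  ∑ i, normalCoord 𝓘(ℝ, E) I f S V (k x) (U (k x)) i • V' i x

variable [IsManifold I ∞ N] [FiniteDimensional ℝ E]

theorem smoothAlong_transportField (hf : ContMDiffOn 𝓘(ℝ, E) I ∞ f S) (hS : UniqueDiffOn ℝ S)
    (hf' : ContMDiffOn 𝓘(ℝ, G) I ∞ f' T) (hV : IsNormalFrame 𝓘(ℝ, E) I f S S V)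
    (hV' : IsNormalFrame 𝓘(ℝ, G) I f' T T V') (hk : ContDiffOn ℝ ∞ k T) (hkT : MapsTo k T S)
    {U : E → E'} (hU : SmoothAlong 𝓘(ℝ, E) I f U S) :
    SmoothAlong 𝓘(ℝ, G) I f' (transportField I f S V V' k U) T :=
  SmoothAlong.sum hf' _ fun i _ ↦ SmoothAlong.smul
    ((contDiffOn_pi.1 (hV.contDiffOn_inverse hf hS Subset.rfl hU).fst i).comp hk hkT).contMDiffOn
    (hV'.smooth i)

theorem IsFraming.transport [FiniteDimensional ℝ G]
    (hf : ContMDiffOn 𝓘(ℝ, E) I ∞ f S) (hS : UniqueDiffOn ℝ S)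
    (hf' : ContMDiffOn 𝓘(ℝ, G) I ∞ f' T) (hV : IsNormalFrame 𝓘(ℝ, E) I f S S V)
    (hV' : IsNormalFrame 𝓘(ℝ, G) I f' T T V') (hk : ContDiffOn ℝ ∞ k T) (hkT : MapsTo k T S)
    {n : ℕ} {B : ∀ x, Submodule ℝ (NormalSpace 𝓘(ℝ, E) I f S x)}
    {Φ : Fin n → ∀ x, NormalSpace 𝓘(ℝ, E) I f S x} (hΦ : IsFraming 𝓘(ℝ, E) I f S B Φ)
    {U : Fin n → E → E'} (hU : ∀ i, SmoothAlong 𝓘(ℝ, E) I f (U i) S)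
    (hΦU : ∀ i, ∀ x ∈ S, Φ i x = Submodule.Quotient.mk (show TangentSpace I (f x) from U i x)) :
    ∃ B', IsFraming 𝓘(ℝ, G) I f' T B' fun i x ↦ Submodule.Quotient.mk
      (show TangentSpace I (f' x) from (transportField I f S V V' k (U i) x : E')) := by
  refine ⟨_, fun i ↦ ⟨_, smoothAlong_transportField hf hS hf' hV hV' hk hkT (hU i), fun x _ ↦ rfl⟩,
    fun x hx ↦ ?_, fun x _ ↦ rfl⟩
  have hU : LinearIndependent ℝ fun i ↦ normalCoord 𝓘(ℝ, E) I f S V (k x) (U i (k x)) := by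
    refine linearIndependent_map_of_ker_le (E := E') (L := (tangentImage 𝓘(ℝ, E) I f S (k x)).mkQ)
      (L' := (normalCoord 𝓘(ℝ, E) I f S V (k x)).toLinearMap) ?_ ?_
    · exact (hV.ker_normalCoord (hkT hx)).le.trans
        (Submodule.ker_mkQ (tangentImage 𝓘(ℝ, E) I f S (k x))).ge
    · have h := hΦ.linearIndependent (k x) (hkT hx)
      simp only [hΦU _ _ (hkT hx)] at h
      exact h
  refine linearIndependent_map_of_ker_le (E := E')
    (L := (normalCoord 𝓘(ℝ, G) I f' T V' x).toLinearMap) (L' := (tangentImage 𝓘(ℝ, G) I f' T x).mkQ)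
    ?_ ?_
  · exact (Submodule.ker_mkQ (tangentImage 𝓘(ℝ, G) I f' T x)).le.trans
      (hV'.ker_normalCoord hx).ge
  · simpa only [ContinuousLinearMap.coe_coe, transportField, hV'.normalCoord_sum hx] using hU

end Transport

section RadialExtension

variable {E F : Type*} [NormedAddCommGroup E] [InnerProductSpace ℝ E] [NormedAddCommGroup F]
  [NormedSpace ℝ F]

theorem exists_contDiff_eqOn_sphere {σ : E → F} (hσ : ContDiffOn ℝ ∞ σ {0}ᶜ)
    (hσ1 : ∀ x ≠ 0, ‖σ x‖ ≤ 1) :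
    ∃ k : E → F, ContDiff ℝ ∞ k ∧ (∀ x, ‖k x‖ ≤ 1) ∧ EqOn k σ (sphere 0 1) := by
  let ρ (x : E) : ℝ := Real.smoothTransition (4 * ‖x‖ ^ 2 - 2)
  have hρ : ContDiff ℝ ∞ ρ := Real.smoothTransition.contDiff.comp
    ((contDiff_const.mul (contDiff_norm_sq ℝ)).sub contDiff_const)
  have hρ0 : ∀ x ∈ ball (0 : E) (1 / 2), ρ x = 0 := fun x hx ↦
    Real.smoothTransition.zero_of_nonpos <| by
      nlinarith [norm_nonneg x, mem_ball_zero_iff.1 hx]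
  refine ⟨fun x ↦ ρ x • σ x, contDiff_iff_contDiffAt.2 fun x ↦ ?_, fun x ↦ ?_, fun x hx ↦ ?_⟩
  · obtain rfl | hx := eq_or_ne x 0
    · refine contDiffAt_const (c := 0) |>.congr_of_eventuallyEq ?_
      filter_upwards [ball_mem_nhds 0 one_half_pos] with y hy
      rw [hρ0 y hy, zero_smul]
    · exact hρ.contDiffAt.smul (hσ.contDiffAt (isOpen_compl_singleton.mem_nhds hx))
  · obtain rfl | hx := eq_or_ne x 0
    · simp [hρ0 0 (mem_ball_self one_half_pos)]
    · rw [norm_smul, Real.norm_of_nonneg (Real.smoothTransition.nonneg _)]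
      exact mul_le_one₀ (Real.smoothTransition.le_one _) (norm_nonneg _) (hσ1 x hx)
  · have hρ1 : ρ x = 1 := Real.smoothTransition.one_of_one_le <| by
      rw [mem_sphere_zero_iff_norm.1 hx]
      norm_num
    simp only [hρ1, one_smul]

end RadialExtension

section Admissible

variable {H W H' Y : Type*} [TopologicalSpace H] {I : ModelWithCorners ℝ (Euc 5) H}
  [TopologicalSpace W] [T2Space W] [ChartedSpace H W] [IsManifold I ∞ W]
  {f f' : Euc 2 → W}

theorem IsEmbeddedDisk.exists_boundary_lift (hf : IsEmbeddedDisk I f) (hf' : IsEmbeddedDisk I f')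
    (hbd : f' '' sphere 0 1 ⊆ f '' sphere 0 1) :
    ∃ k : Euc 2 → Euc 2, ContDiff ℝ ∞ k ∧ (∀ x, k x ∈ disk) ∧
      ∀ x ∈ sphere (0 : Euc 2) 1, k x ∈ sphere (0 : Euc 2) 1 ∧ f (k x) = f' x := by
  have hdir : MapsTo (direction : Euc 2 → Euc 2) {0}ᶜ (sphere 0 1) := fun x hx ↦
    mem_sphere_zero_iff_norm.2 (norm_direction hx)
  have hmaps : MapsTo (f' ∘ direction) {0}ᶜ (f '' sphere 0 1) := fun x hx ↦
    hbd (mem_image_of_mem f' (hdir hx))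
  obtain ⟨σ, hσ, hσd, hfσ, -⟩ := hf.isEmbeddedOn.exists_lift isOpen_compl_singleton.uniqueMDiffOn
    (hf'.smooth.comp contDiffOn_direction.contMDiffOn (hdir.mono_right sphere_subset_closedBall))
    (hmaps.mono_right (image_mono sphere_subset_closedBall))
  obtain ⟨k, hk, hkd, hkσ⟩ := exists_contDiff_eqOn_sphere hσ.contDiffOn fun x hx ↦
    mem_closedBall_zero_iff.1 (hσd hx)
  refine ⟨k, hk, fun x ↦ mem_closedBall_zero_iff.2 (hkd x), fun x hx ↦ ?_⟩
  have hx0 : x ∈ ({0}ᶜ : Set (Euc 2)) := ne_of_mem_sphere hx one_ne_zero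
  have hfk : f (k x) = f' x := by
    rw [hkσ hx, ← Function.comp_apply (f := f), ← hfσ hx0, Function.comp_apply]
    rw [direction, mem_sphere_zero_iff_norm.1 hx, inv_one, one_smul]
  obtain ⟨y, hy, hyx⟩ := hbd (mem_image_of_mem f' hx)
  obtain rfl := hf.injOn (sphere_subset_closedBall hy) (mem_closedBall_zero_iff.2 (hkd x))
    (hyx.trans hfk.symm)
  exact ⟨hy, hfk⟩

theorem IsAdmissible.of_agreeOnBoundary [TopologicalSpace H']
    {J : ModelWithCorners ℝ (Euc 3) H'} [TopologicalSpace Y] [ChartedSpace H' Y]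
    {ι : Y → W} {γ : Circ → Y} {φ : NormalPair J γ} {V V' : Fin 3 → Euc 2 → Euc 5}
    (h : IsAdmissible J I ι γ f φ) (hf : IsEmbeddedDisk I f) (hf' : IsEmbeddedDisk I f')
    (hbd : f' '' sphere 0 1 ⊆ f '' sphere 0 1) (hV : IsNormalFrame 𝓘(ℝ, Euc 2) I f disk disk V)
    (hV' : IsNormalFrame 𝓘(ℝ, Euc 2) I f' disk disk V') (hVV' : AgreeOnBoundary I f f' V V') :
    IsAdmissible J I ι γ f' φ := by
  obtain ⟨B, Φ, hΦ, hext⟩ := h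
  choose U hU hΦU using hΦ.smooth
  obtain ⟨k, hk, hkd, hks⟩ := hf.exists_boundary_lift hf' hbd
  obtain ⟨B', hB'⟩ := hΦ.transport hf.smooth hf.isEmbeddedOn.uniqueMDiffOn.uniqueDiffOn hf'.smooth
    hV hV' hk.contDiffOn (fun x _ ↦ hkd x) hU hΦU
  refine ⟨B', _, hB', fun x hx θ hxθ i v hv ↦ ?_⟩
  obtain ⟨hkx, hfk⟩ := hks x hx
  let u : Euc 5 := U i (k x)
  let w : Euc 5 := mfderiv J I ι (γ θ) v
  have huw : u - w ∈ (differential 𝓘(ℝ, Euc 2) I f disk (k x)).range :=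
    (Submodule.Quotient.eq _).1 <|
      (hΦU i (k x) (hkd x)).symm.trans (hext (k x) hkx θ (hfk.trans hxθ) i v hv)
  have huU' : u - transportField I f disk V V' k (U i) x ∈
      (differential 𝓘(ℝ, Euc 2) I f disk (k x)).range := by
    simpa only [transportField, hVV'.frame_eq x hx (k x) hkx hfk.symm] using
      hV.sub_sum_normalCoord_mem_range (hkd x) u
  refine (Submodule.Quotient.eq _).2 ?_
  change transportField I f disk V V' k (U i) x - w ∈
    (differential 𝓘(ℝ, Euc 2) I f' disk x).range
  rw [hVV'.range_eq x hx (k x) hkx hfk.symm]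
  simpa only [sub_sub_sub_cancel_left] using Submodule.sub_mem _ huw huU'

end Admissible

end Tubing

theorem lemma5p4_general
    {H W H' Y : Type*}
    [TopologicalSpace H] {I : ModelWithCorners ℝ (Euc 5) H}
    [TopologicalSpace W] [T2Space W] [ChartedSpace H W] [IsManifold I ∞ W]
    [TopologicalSpace H'] {J : ModelWithCorners ℝ (Euc 3) H'}
    [TopologicalSpace Y] [ChartedSpace H' Y] [IsManifold J ∞ Y]
    (ι : Y → W) (_hι : ContMDiff J I ∞ ι) (γ : Circ → Y) (_hγ : ContMDiff (𝓡 1) J ∞ γ)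
    (Δ : Euc 2 → W) (hΔ : IsEmbeddedDisk I Δ) (_hΔγ : Δ '' sphere 0 1 = range (ι ∘ γ))
    (R : Sph → W) (hR : Manifold.IsSmoothEmbedding (𝓡 2) I ∞ R)
    (hRtriv : HasTrivialNormalBundle (𝓡 2) I 3 R) (hRΔ : Disjoint (range R) (Δ '' disk))
    (Δ' : Euc 2 → W) (htube : IsTubing I Δ R Δ') (φ : NormalPair J γ) :
    IsAdmissible J I ι γ Δ φ ↔ IsAdmissible J I ι γ Δ' φ := by
  obtain ⟨hΔ', hbd, -⟩ := id htube
  obtain ⟨V, hV⟩ : ∃ V : Fin 3 → Euc 2 → Euc 5, IsNormalFrame 𝓘(ℝ, Euc 2) I Δ disk disk V :=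
    exists_isNormalFrame_of_starConvex (by simp) (isCompact_closedBall 0 1)
      ((convex_closedBall 0 1).starConvex (mem_closedBall_self zero_le_one))
      (mem_closedBall_self zero_le_one) hΔ.isEmbeddedOn.uniqueMDiffOn.uniqueDiffOn hΔ.smooth
      hΔ.immersive
  obtain ⟨V', hV', hVV'⟩ := htube.exists_isNormalFrame hΔ hR hRtriv hRΔ hV
  exact ⟨fun h ↦ h.of_agreeOnBoundary hΔ hΔ' hbd.subset hV hV' hVV',
    fun h ↦ h.of_agreeOnBoundary hΔ' hΔ hbd.superset hV' hV hVV'.symm⟩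

theorem lemma5p4
    {H W H' Y : Type*}
    [TopologicalSpace H] {I : ModelWithCorners ℝ (Euc 5) H}
    [TopologicalSpace W] [T2Space W] [ChartedSpace H W] [IsManifold I ∞ W]
    [TopologicalSpace H'] {J : ModelWithCorners ℝ (Euc 3) H'}
    [TopologicalSpace Y] [ChartedSpace H' Y] [IsManifold J ∞ Y]
    (ι : Y → W) (hι : Manifold.IsSmoothEmbedding J I ∞ ι)
    (γ : Circ → Y) (hγ : Manifold.IsSmoothEmbedding (𝓡 1) J ∞ γ)
    (Δ : Euc 2 → W) (hΔ : IsSpanningDisk I ι γ Δ)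
    (R : Sph → W) (hR : Manifold.IsSmoothEmbedding (𝓡 2) I ∞ R)
    (hRtriv : HasTrivialNormalBundle (𝓡 2) I 3 R)
    (hRΔ : Disjoint (range R) (Δ '' disk)) (hRY : Disjoint (range R) (range ι))
    (Δ' : Euc 2 → W) (htube : IsTubing I Δ R Δ') (hΔ' : IsSpanningDisk I ι γ Δ')
    (φ : NormalPair J γ) (hφ : IsFraming (𝓡 1) J γ univ (fun _ ↦ ⊤) φ) :
    IsAdmissible J I ι γ Δ φ ↔ IsAdmissible J I ι γ Δ' φ :=
  lemma5p4_general ι hι.isImmersion.contMDiff γ hγ.isImmersion.contMDiff Δ hΔ.embedded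
    hΔ.boundary_eq R hR hRtriv hRΔ Δ' htube φ
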